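/- A monic polynomial $f(x)\in\mathbb{Z}[x]$ is called monogenic if it is irreducible over $\mathbb{Q}$ and, for every root $\theta\in\mathbb{C}$ of $f$, the powers $1,\theta,\dots,\theta^{\deg f-1}$ form a $\mathbb{Z}$-basis of the ring of integers of $\mathbb{Q}(\theta)$. Let $b,N\in\mathbb{Z}$ with $b\ge 1$, $N\ge 3$ and $N\equiv 3\pmod 4$. Define \[f_{N,b}(x)=x^N-x-(N-1)N^b\quad\text{and}\quad \delta=\delta_{N,b}:=1-N^{(b+1)N-b}.\] Suppose that $f_{N,b}(x)$ is irreducible over $\mathbb{Q}$. Then: 1. $f_{N,b}(x)$ is monogenic if and only if $\delta$ is squarefree. 2. No two such monogenic trinomials generate the same extension of $\mathbb{Q}$: if $b'\ge 1$, $b'\neq b$, and $f_{N,b}(x)$ and $f_{N,b'}(x)$ are both monogenic with $f_{N,b}(\theta)=0=f_{N,b'}(\theta')$, then the degree-$N$ fields $\mathbb{Q}(\theta)$ and $\mathbb{Q}(\theta')$ are not isomorphic (in particular, not equal). 3. $\delta<0$, $\mathbb{Q}(\sqrt{\delta})$ is an imaginary quadratic field, and its ideal class group contains an element of order exactly $(b+1)N-b$.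 -/

import Mathlib

open Polynomial
open scoped NumberField

/-- A polynomial `f ∈ ℤ[x]` is monogenic if it is monic, irreducible over `ℚ`, and for every complex
root `θ` of `f` the powers `1, θ, …, θ ^ (deg f - 1)` form a `ℤ`-basis of the ring of integers of
`ℚ(θ)`. -/
def IsMonogenicPoly (f : ℤ[X]) : Prop :=
  f.Monic ∧ Irreducible (f.map (Int.castRingHom ℚ)) ∧
    ∀ θ : ℂ, aeval θ f = 0 →
      ∃ B : Module.Basis (Fin f.natDegree) ℤ (𝓞 (IntermediateField.adjoin ℚ {θ})),
        ∀ i, (((B i : 𝓞 (IntermediateField.adjoin ℚ {θ})) : IntermediateField.adjoin ℚ {θ}) : ℂ)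
          = θ ^ (i : ℕ)

/-- The trinomial `f_{N,b}(x) = x ^ N - x - (N - 1) N ^ b`. -/
noncomputable def trinomialNb (N b : ℕ) : ℤ[X] :=
  X ^ N - X - C (((N : ℤ) - 1) * (N : ℤ) ^ b)

/-- The integer `δ = 1 - N ^ ((b + 1) N - b)`; note that `b ≤ (b + 1) N` whenever `1 ≤ N`. -/
def deltaNb (N b : ℕ) : ℤ := 1 - (N : ℤ) ^ ((b + 1) * N - b)

/-! Everything rests on two identities. A root satisfies θ f'(θ) = (N - 1)(θ + N ^ (b + 1)), and at
-N ^ (b + 1) the trinomial f has value N ^ b δ and derivative -δ. So only primes dividing (N - 1)δ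
can obstruct monogenicity, and N - 1 divides δ.

If δ is squarefree, every nonzero prime of ℤ[θ] is locally principal (`exists_local_generator`), so
ℤ[θ] is Dedekind and contains all integers of ℚ(θ). If p ^ 2 ∣ δ, some monic q of degree below N
makes q(θ) / p integral, which a power basis forbids. Taking norms in the first identity gives field
discriminant ±(N - 1) ^ (N - 1) δ with a sign depending only on N. Since δ determines b, fields for
different b are not isomorphic.

For the class group put m = (b + 1)N - b and σ = √δ. The ideals (1 + σ) and (1 - σ) are coprime with
product (N) ^ m, so (1 + σ) = I ^ m. If the class of I had smaller order, ±(1 + σ) would be a proper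
r-th power of an integer x + t, r an odd prime and t a rational multiple of σ. Comparing real parts
forces x = ±1 and Re (1 + √w) ^ r = ±1, where w = 1 - N ^ (m / r). p-adic estimates leave only w =
-2, r = 5, that is N = 3, b = 1, where f has the root 2. -/

/-! ### Local generators of primes and a criterion for Dedekind domains. -/

/-- Modulo p the preimage of P is generated by one polynomial g, and h = g k there. From h' = g' k +
g k' and h'(θ) ∉ P it follows that k(θ) ∉ P. So κ = k(θ) works: multiplying a multiple of g by k
gives a multiple of h modulo p. Thus P is generated by p and h(θ) after localizing. -/
theorem exists_mul_mem_span_pair {A : Type*} [CommRing A] (θ : A)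
    (hsurj : ∀ a : A, ∃ q : ℤ[X], aeval θ q = a) (P : Ideal A) [P.IsPrime]
    (p : ℕ) [hp : Fact p.Prime] (hpP : (p : A) ∈ P) (h : ℤ[X])
    (hh : aeval θ h ∈ P) (hh' : aeval θ (derivative h) ∉ P) :
    ∃ κ : A, κ ∉ P ∧ ∀ y ∈ P, κ * y ∈ Ideal.span {(p : A), aeval θ h} := by
  set φ : ℤ[X] →+* (ZMod p)[X] := mapRingHom (Int.castRingHom (ZMod p)) with hφ
  have hφs : Function.Surjective φ := map_surjective _ (ZMod.ringHom_surjective _)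
  have hker : ∀ u : ℤ[X], φ u = 0 → ∃ v, u = (p : ℤ[X]) * v := by
    intro u hu
    have : C (p : ℤ) ∣ u := by
      rw [C_dvd_iff_dvd_coeff]
      intro i
      have := congrArg (fun q => coeff q i) hu
      simp only [hφ, coe_mapRingHom, coeff_map, coeff_zero, eq_intCast] at this
      exact (ZMod.intCast_zmod_eq_zero_iff_dvd _ _).1 this |>.trans dvd_rfl
    obtain ⟨v, hv⟩ := this
    exact ⟨v, by simpa using hv⟩
  set Q : Ideal ℤ[X] := P.comap (aeval θ : ℤ[X] →ₐ[ℤ] A)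
  obtain ⟨g, hg⟩ := (IsPrincipalIdealRing.principal (Q.map φ)).principal
  have hmem : ∀ u : ℤ[X], φ u ∈ Q.map φ → aeval θ u ∈ P := by
    intro u hu
    obtain ⟨v, hv, huv⟩ := (Ideal.mem_map_iff_of_surjective φ hφs).1 hu
    obtain ⟨z, hz⟩ := hker (u - v) (by rw [map_sub, huv, sub_self])
    have : aeval θ u = aeval θ v + (p : A) * aeval θ z := by
      rw [eq_add_of_sub_eq' hz]; simp
    rw [this]
    exact P.add_mem hv (P.mul_mem_right _ hpP)
  have hmem' : ∀ u : ℤ[X], aeval θ u ∈ P → ∃ v, φ u = g * v := by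
    intro u hu
    have : φ u ∈ Q.map φ := Ideal.mem_map_of_mem _ hu
    rw [hg] at this
    obtain ⟨v, hv⟩ := Ideal.mem_span_singleton'.1 this
    exact ⟨v, by rw [← hv, mul_comm]⟩
  obtain ⟨k', hk'⟩ := hmem' h hh
  obtain ⟨k, rfl⟩ := hφs k'
  obtain ⟨G, rfl⟩ := hφs g
  have hGQ : φ G ∈ Q.map φ := by rw [hg]; exact Ideal.mem_span_singleton_self _
  refine ⟨aeval θ k, fun hk => hh' (hmem _ ?_), fun y hy => ?_⟩
  · have h1 : φ (derivative h) = φ (derivative G) * φ k + φ G * φ (derivative k) := by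
      have := congrArg derivative hk'
      simpa [hφ, derivative_map, derivative_mul] using this
    rw [h1]
    exact Ideal.add_mem _ (Ideal.mul_mem_left _ _ (Ideal.mem_map_of_mem _ hk))
      (Ideal.mul_mem_right _ _ hGQ)
  · obtain ⟨u, rfl⟩ := hsurj y
    obtain ⟨v', hv'⟩ := hmem' u hy
    obtain ⟨v, rfl⟩ := hφs v'
    obtain ⟨z, hz⟩ := hker (k * u - h * v) (by
      simp only [map_sub, map_mul, hv', hk']; ring)
    rw [Ideal.mem_span_pair]
    refine ⟨aeval θ z, aeval θ v, ?_⟩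
    have := congrArg (aeval θ) hz
    simp only [map_sub, map_mul, map_natCast] at this
    linear_combination -this

/-- In the localization at P the element κ is a unit, so π generates the maximal ideal, and a
Noetherian local domain that is not a field and has principal maximal ideal is a discrete valuation
ring. -/
theorem isDedekindDomain_of_locally_principal {A : Type*} [CommRing A] [IsDomain A]
    [IsNoetherianRing A]
    (H : ∀ P : Ideal A, P ≠ ⊥ → P.IsPrime →
      ∃ π ∈ P, ∃ κ : A, κ ∉ P ∧ ∀ y ∈ P, κ * y ∈ Ideal.span {π}) : IsDedekindDomain A := by
  have : IsDedekindDomainDvr A := by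
    refine { is_dvr_at_nonzero_prime := ?_ }
    intro P hP0 hP
    have hNF : ¬ IsField (Localization.AtPrime P) := by
      refine IsLocalization.AtPrime.not_isField A hP0 _
    have : IsNoetherianRing (Localization.AtPrime P) :=
      IsLocalization.isNoetherianRing P.primeCompl _ inferInstance
    refine ((IsDiscreteValuationRing.TFAE (Localization.AtPrime P) hNF).out 4 0).1 ?_
    obtain ⟨π, hπ, κ, hκ, h⟩ := H P hP0 hP
    refine ⟨⟨algebraMap A _ π, ?_⟩⟩
    rw [← Localization.AtPrime.map_eq_maximalIdeal]
    apply le_antisymm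
    · rw [Ideal.map_le_iff_le_comap]
      intro y hy
      obtain ⟨z, hz⟩ := Ideal.mem_span_singleton'.1 (h y hy)
      have hu : IsUnit (algebraMap A (Localization.AtPrime P) κ) :=
        IsLocalization.map_units _ (⟨κ, hκ⟩ : P.primeCompl)
      obtain ⟨w, hw⟩ := hu.exists_left_inv
      refine Ideal.mem_span_singleton'.2 ⟨w * algebraMap A _ z, ?_⟩
      rw [mul_assoc, ← map_mul, hz, map_mul, ← mul_assoc, hw, one_mul]
    · change Ideal.span _ ≤ _
      rw [Ideal.span_singleton_le_iff_mem]
      exact Ideal.mem_map_of_mem _ hπ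
  infer_instance

/-! ### The trinomial around -N ^ (b + 1), and the primes of ℤ[θ]. -/

theorem delta_exponent_eq {N : ℕ} (hN : 1 ≤ N) (b : ℕ) :
    (b + 1) * N - b = (b + 1) * (N - 1) + 1 := by
  obtain ⟨n, rfl⟩ := Nat.exists_eq_add_of_le' hN
  simp only [Nat.add_sub_cancel]
  have : (b + 1) * (n + 1) = (b + 1) * n + 1 + b := by ring
  omega

/-- Taylor expansion at -N ^ (b + 1): both the value and the derivative there are multiples of δ, so
this point is a double root modulo every prime divisor of δ. -/
theorem trinomial_expansion {R : Type*} [CommRing R] {N : ℕ} (hN : Odd N) (b : ℕ) (x : R) :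
    ∃ k : R, x ^ N - x - ((N : R) - 1) * (N : R) ^ b =
      (N : R) ^ b * (deltaNb N b : R) - (deltaNb N b : R) * (x + (N : R) ^ (b + 1))
        + k * (x + (N : R) ^ (b + 1)) ^ 2 := by
  obtain ⟨k, hk⟩ := Polynomial.powAddExpansion (-(N : R) ^ (b + 1)) (x + (N : R) ^ (b + 1)) N
  refine ⟨k, ?_⟩
  obtain ⟨n, rfl⟩ := hN
  have h1 : -(((2 * n + 1 : ℕ) : R) ^ (b + 1)) + (x + ((2 * n + 1 : ℕ) : R) ^ (b + 1)) = x := by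
    ring
  rw [h1] at hk
  rw [hk, deltaNb, delta_exponent_eq (by omega)]
  simp only [Nat.add_sub_cancel, Odd.neg_pow ⟨n, rfl⟩, Even.neg_pow ⟨n, two_mul n⟩,
    ← pow_mul]
  simp only [Int.cast_sub, Int.cast_one, Int.cast_pow, Int.cast_natCast]
  generalize ((2 * n + 1 : ℕ) : R) = M
  obtain ⟨y, rfl⟩ : ∃ y, x = y - M ^ (b + 1) := ⟨x + M ^ (b + 1), by ring⟩
  rw [sub_add_cancel]
  ring

theorem pred_dvd_delta (N b : ℕ) : ((N : ℤ) - 1) ∣ deltaNb N b := by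
  rw [deltaNb, dvd_sub_comm]
  simpa using sub_dvd_pow_sub_pow (N : ℤ) 1 ((b + 1) * N - b)

/-- A prime of `ℤ[θ]`, where `θ ^ N - θ = (N - 1) N ^ b`, is locally principal as soon as `δ` is
squarefree. -/
theorem exists_local_generator {A : Type*} [CommRing A] {N b : ℕ} (hN : 1 < N)
    (hodd : Odd N) (hsq : Squarefree (deltaNb N b)) (θ : A)
    (hθ : θ ^ N - θ - ((N : A) - 1) * (N : A) ^ b = 0)
    (hsurj : ∀ a : A, ∃ q : ℤ[X], aeval θ q = a) (P : Ideal A) (hP : P.IsPrime)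
    (p : ℕ) (hp : p.Prime) (hpP : (p : A) ∈ P) :
    ∃ π ∈ P, ∃ κ : A, κ ∉ P ∧ ∀ y ∈ P, κ * y ∈ Ideal.span {π} := by
  have : Fact p.Prime := ⟨hp⟩
  have hone : (1 : A) ∉ P := (Ideal.ne_top_iff_one P).1 hP.ne_top
  have hint : ∀ z : ℤ, (z : A) ∈ P → (p : ℤ) ∣ z := by
    intro z hz
    by_contra hz'
    have hco : IsCoprime (p : ℤ) z :=
      (Nat.prime_iff_prime_int.1 hp).irreducible.coprime_iff_not_dvd.2 hz'
    obtain ⟨u, v, huv⟩ := hco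
    apply hone
    have : (1 : A) = (u : A) * (p : A) + (v : A) * (z : A) := by
      rw [← Int.cast_one, ← huv]; push_cast; ring
    rw [this]
    exact P.add_mem (P.mul_mem_left _ hpP) (P.mul_mem_left _ hz)
  have hpnat : ∀ z : ℕ, (z : A) ∈ P → p ∣ z := fun z hz =>
    Int.natCast_dvd_natCast.1 (hint z (by simpa using hz))
  have hder : aeval θ (derivative (trinomialNb N b)) = (N : A) * θ ^ (N - 1) - 1 := by
    rw [trinomialNb, derivative_sub, derivative_sub, derivative_X_pow, derivative_X, derivative_C]
    simp
  have hval : aeval θ (trinomialNb N b) = 0 := by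
    rw [← hθ]; simp [trinomialNb]
  by_cases h1 : aeval θ (derivative (trinomialNb N b)) ∈ P
  swap
  -- When f'(θ) ∉ P, the choice h = f has h(θ) = 0, so p alone generates P locally.
  · obtain ⟨κ, hκ, H⟩ := exists_mul_mem_span_pair θ hsurj P p hpP (trinomialNb N b)
      (by rw [hval]; exact P.zero_mem) h1
    refine ⟨p, hpP, κ, hκ, fun y hy => ?_⟩
    have := H y hy
    rw [hval] at this
    obtain ⟨r, s, hrs⟩ := Ideal.mem_span_pair.1 this
    exact Ideal.mem_span_singleton'.2 ⟨r, by rw [← hrs]; ring⟩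
  rw [hder] at h1
  have hNsucc : θ ^ N = θ ^ (N - 1) * θ := by rw [← pow_succ]; congr 1; omega
  have hpN : ¬ p ∣ N := by
    rintro ⟨r, hr⟩
    apply hone
    have : (1 : A) = (p : A) * ((r : A) * θ ^ (N - 1)) - ((N : A) * θ ^ (N - 1) - 1) := by
      have : (N : A) = p * r := by exact_mod_cast congrArg (Nat.cast (R := A)) hr
      rw [this]; ring
    rw [this]
    exact P.sub_mem (P.mul_mem_right _ hpP) h1
  by_cases h2 : p ∣ N - 1
  -- With N - 1 = p t, modulo p the trinomial is x (x ^ t - 1) ^ p; the generator will be θ ^ t - 1.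
  · obtain ⟨t, ht⟩ := h2
    have hNt : N = p * t + 1 := by omega
    have hN1 : (N : A) - 1 = (p : A) * (t : A) := by rw [hNt]; push_cast; ring
    have hpt : ¬ p ∣ t := by
      rintro ⟨r, hr⟩
      have h3 : (p : ℤ) * (p : ℤ) ∣ deltaNb N b := by
        refine Dvd.dvd.trans ⟨(r : ℤ), ?_⟩ (pred_dvd_delta N b)
        rw [hNt, hr]; push_cast; ring
      exact (Nat.prime_iff_prime_int.1 hp).not_isUnit (hsq _ h3)
    have hpow : θ ^ (N - 1) - 1 ∈ P := by
      have : θ ^ (N - 1) - 1 = ((N : A) * θ ^ (N - 1) - 1) - (p : A) * ((t : A) * θ ^ (N - 1)) := by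
        linear_combination (-θ ^ (N - 1)) * hN1
      rw [this]
      exact P.sub_mem h1 (P.mul_mem_right _ hpP)
    have hθP : θ ∉ P := by
      intro h
      apply hone
      have : (1 : A) = θ ^ (N - 1) - (θ ^ (N - 1) - 1) := by ring
      rw [this]
      exact P.sub_mem (P.pow_mem_of_mem h _ (by omega)) hpow
    obtain ⟨s, hs⟩ := exists_add_pow_prime_eq hp (θ ^ t - 1) (1 : A)
    rw [sub_add_cancel, ← pow_mul, mul_comm t p, ← ht] at hs
    have huP : θ ^ t - 1 ∈ P := by
      refine hP.mem_of_pow_mem p ?_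
      have : (θ ^ t - 1) ^ p = (θ ^ (N - 1) - 1) - (p : A) * ((θ ^ t - 1) * s) := by
        rw [hs]; ring
      rw [this]
      exact P.sub_mem hpow (P.mul_mem_right _ hpP)
    -- The cofactor of p lies outside P, so p is locally a multiple of θ ^ t - 1 and can be dropped
    -- from the pair of generators.
    have heq : (p : A) * ((t : A) * (N : A) ^ b - θ * (θ ^ t - 1) * s) = θ * (θ ^ t - 1) ^ p := by
      rw [hNsucc, hs, hN1] at hθ
      linear_combination -hθ
    have hκ' : (t : A) * (N : A) ^ b - θ * (θ ^ t - 1) * s ∉ P := by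
      intro h
      have h3 : (t : A) * (N : A) ^ b ∈ P := by
        have := P.add_mem h (P.mul_mem_left (θ * s) huP)
        convert this using 1; ring
      rcases hP.mem_or_mem h3 with h4 | h4
      · exact hpt (hpnat _ h4)
      · exact hpN (hpnat _ (hP.mem_of_pow_mem _ h4))
    have hae : aeval θ (X ^ t - 1 : ℤ[X]) = θ ^ t - 1 := by simp
    obtain ⟨κ, hκ, H⟩ := exists_mul_mem_span_pair θ hsurj P p hpP (X ^ t - 1)
      (by rw [hae]; exact huP) (by
        have : aeval θ (derivative (X ^ t - 1 : ℤ[X])) = (t : A) * θ ^ (t - 1) := by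
          rw [derivative_sub, derivative_X_pow, derivative_one]; simp
        rw [this]
        intro h
        rcases hP.mem_or_mem h with h4 | h4
        · exact hpt (hpnat _ h4)
        · exact hθP (hP.mem_of_pow_mem _ h4))
    refine ⟨θ ^ t - 1, huP, _ * κ, fun h => (hP.mem_or_mem h).elim hκ' hκ, fun y hy => ?_⟩
    have := H y hy
    rw [hae] at this
    obtain ⟨r, v, hrs⟩ := Ideal.mem_span_pair.1 this
    obtain ⟨p', hp'⟩ : ∃ p', p = p' + 1 := ⟨p - 1, by have := hp.one_lt; omega⟩
    refine Ideal.mem_span_singleton'.2 ⟨r * θ * (θ ^ t - 1) ^ p' +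
      ((t : A) * (N : A) ^ b - θ * (θ ^ t - 1) * s) * v, ?_⟩
    rw [mul_assoc _ κ, ← hrs]
    have h5 : (θ ^ t - 1) ^ p = (θ ^ t - 1) ^ p' * (θ ^ t - 1) := by rw [hp', pow_succ]
    rw [h5] at heq
    linear_combination (-r) * heq
  -- Here p ∤ N - 1, so θ f'(θ) ∈ P puts θ + N ^ (b + 1) in P. The expansion then gives p ∣ δ, and
  -- since p divides δ only once, it expresses p locally as a multiple of θ + N ^ (b + 1).
  · obtain ⟨k, hk⟩ := trinomial_expansion hodd b θ
    have huP : θ + (N : A) ^ (b + 1) ∈ P := by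
      have h3 : ((N - 1 : ℕ) : A) * (θ + (N : A) ^ (b + 1)) ∈ P := by
        have : ((N - 1 : ℕ) : A) * (θ + (N : A) ^ (b + 1)) = θ * ((N : A) * θ ^ (N - 1) - 1) := by
          rw [hNsucc] at hθ
          rw [Nat.cast_sub hN.le, Nat.cast_one]
          linear_combination (-(N : A)) * hθ
        rw [this]
        exact P.mul_mem_left _ h1
      exact (hP.mem_or_mem h3).resolve_left fun h => h2 (hpnat _ h)
    rw [hθ] at hk
    have hdP : (p : ℤ) ∣ deltaNb N b := by
      have h3 : (N : A) ^ b * (deltaNb N b : A) ∈ P := by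
        have : (N : A) ^ b * (deltaNb N b : A) =
          ((deltaNb N b : A) - k * (θ + (N : A) ^ (b + 1))) * (θ + (N : A) ^ (b + 1)) := by
          linear_combination -hk
        rw [this]
        exact P.mul_mem_left _ huP
      rcases hP.mem_or_mem h3 with h4 | h4
      · exact absurd (hpnat _ (hP.mem_of_pow_mem _ h4)) hpN
      · exact hint _ h4
    obtain ⟨e, he⟩ := hdP
    have hpe : ¬ (p : ℤ) ∣ e := by
      rintro ⟨r, hr⟩
      refine (Nat.prime_iff_prime_int.1 hp).not_isUnit (hsq _ ⟨r, ?_⟩)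
      rw [he, hr]; ring
    have hκ' : (N : A) ^ b * (e : A) ∉ P := by
      intro h
      rcases hP.mem_or_mem h with h4 | h4
      · exact hpN (hpnat _ (hP.mem_of_pow_mem _ h4))
      · exact hpe (hint _ h4)
    have hae : aeval θ (X + C ((N : ℤ) ^ (b + 1)) : ℤ[X]) = θ + (N : A) ^ (b + 1) := by simp
    obtain ⟨κ, hκ, H⟩ := exists_mul_mem_span_pair θ hsurj P p hpP (X + C ((N : ℤ) ^ (b + 1)))
      (by rw [hae]; exact huP) (by rw [derivative_add, derivative_X, derivative_C]; simpa using hone)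
    refine ⟨θ + (N : A) ^ (b + 1), huP, _ * κ, fun h => (hP.mem_or_mem h).elim hκ' hκ,
      fun y hy => ?_⟩
    have := H y hy
    rw [hae] at this
    obtain ⟨r, v, hrs⟩ := Ideal.mem_span_pair.1 this
    have he' : (deltaNb N b : A) = (p : A) * (e : A) := by rw [he]; push_cast; ring
    refine Ideal.mem_span_singleton'.2 ⟨r * ((deltaNb N b : A) - k * (θ + (N : A) ^ (b + 1))) +
      (N : A) ^ b * (e : A) * v, ?_⟩
    rw [mul_assoc _ κ, ← hrs]
    linear_combination r * hk + r * (N : A) ^ b * he'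

/-! ### Comparing ℤ[θ] with the ring of integers. -/

theorem minpoly_eq_map_of_irreducible {f : ℤ[X]} (hf : f.Monic)
    (hirr : Irreducible (f.map (Int.castRingHom ℚ))) {θ : ℂ} (hθ : aeval θ f = 0) :
    minpoly ℚ θ = f.map (Int.castRingHom ℚ) := by
  refine (minpoly.eq_of_irreducible_of_monic hirr ?_ (hf.map _)).symm
  exact (aeval_map_algebraMap ℚ θ f).trans hθ

theorem natDegree_minpoly_of_irreducible {f : ℤ[X]} (hf : f.Monic)
    (hirr : Irreducible (f.map (Int.castRingHom ℚ))) {θ : ℂ} (hθ : aeval θ f = 0) :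
    (minpoly ℚ θ).natDegree = f.natDegree := by
  rw [minpoly_eq_map_of_irreducible hf hirr hθ, hf.natDegree_map]

theorem eq_zero_of_aeval_eq_zero_of_natDegree_lt {f : ℤ[X]} (hf : f.Monic)
    (hirr : Irreducible (f.map (Int.castRingHom ℚ))) {θ : ℂ} (hθ : aeval θ f = 0)
    {q : ℤ[X]} (hq : q.natDegree < f.natDegree) (h : aeval θ q = 0) : q = 0 := by
  by_contra h0
  have hinj : Function.Injective (Int.castRingHom ℚ) := Int.cast_injective
  have h1 : q.map (Int.castRingHom ℚ) ≠ 0 := (Polynomial.map_ne_zero_iff hinj).2 h0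
  have h2 := natDegree_le_of_dvd (minpoly.dvd ℚ θ ((aeval_map_algebraMap ℚ θ q).trans h)) h1
  change _ ≤ (q.map (Int.castRingHom ℚ)).natDegree at h2
  rw [natDegree_minpoly_of_irreducible hf hirr hθ, natDegree_map_eq_of_injective hinj] at h2
  omega

theorem exists_aeval_eq_mul_of_mem_adjoin {θ : ℂ} (hθ : IsIntegral ℚ θ) {z : ℂ}
    (hz : z ∈ IntermediateField.adjoin ℚ {θ}) :
    ∃ (n : ℤ) (q : ℤ[X]), n ≠ 0 ∧ (n : ℂ) * z = aeval θ q := by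
  have hz' : z ∈ Algebra.adjoin ℚ {θ} := by
    rw [← IntermediateField.adjoin_simple_toSubalgebra_of_isAlgebraic hθ.isAlgebraic]; exact hz
  rw [Algebra.adjoin_singleton_eq_range_aeval] at hz'
  obtain ⟨u, hu⟩ := hz'
  obtain ⟨n, hn0, hn⟩ := IsLocalization.integerNormalization_spec (nonZeroDivisors ℤ) u
  refine ⟨n, IsLocalization.integerNormalization (nonZeroDivisors ℤ) u,
    nonZeroDivisors.ne_zero hn0, ?_⟩
  rw [← aeval_map_algebraMap ℚ θ (IsLocalization.integerNormalization _ u), hn, ← hu]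
  simp [zsmul_eq_mul]

theorem exists_basis_of_integral_mem_adjoin {f : ℤ[X]} (hf : f.Monic)
    (hirr : Irreducible (f.map (Int.castRingHom ℚ))) {θ : ℂ} (hθ : aeval θ f = 0)
    (H : ∀ z ∈ IntermediateField.adjoin ℚ {θ}, IsIntegral ℤ z → z ∈ Algebra.adjoin ℤ {θ}) :
    ∃ B : Module.Basis (Fin f.natDegree) ℤ (𝓞 (IntermediateField.adjoin ℚ {θ})),
        ∀ i, (((B i : 𝓞 (IntermediateField.adjoin ℚ {θ})) : IntermediateField.adjoin ℚ {θ}) : ℂ)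
          = θ ^ (i : ℕ) := by
  have hθi : IsIntegral ℤ θ := ⟨f, hf, hθ⟩
  let v : IntermediateField.adjoin ℚ {θ} →ₐ[ℤ] ℂ := (IntermediateField.val _).restrictScalars ℤ
  have hgi : IsIntegral ℤ (IntermediateField.AdjoinSimple.gen ℚ θ) :=
    (isIntegral_algHom_iff v Subtype.val_injective).1 hθi
  set x : 𝓞 (IntermediateField.adjoin ℚ {θ}) := ⟨IntermediateField.AdjoinSimple.gen ℚ θ, hgi⟩
  let φ : 𝓞 (IntermediateField.adjoin ℚ {θ}) →ₐ[ℤ] ℂ :=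
    v.comp
      (IsScalarTower.toAlgHom ℤ (𝓞 (IntermediateField.adjoin ℚ {θ})) _)
  have hφinj : Function.Injective φ :=
    Subtype.val_injective.comp NumberField.RingOfIntegers.coe_injective
  have hφx : φ x = θ := rfl
  have hli : LinearIndependent ℤ (fun i : Fin f.natDegree => x ^ (i : ℕ)) := by
    apply LinearIndependent.of_comp φ.toLinearMap
    have h1 := linearIndependent_pow (K := ℚ) θ
    rw [natDegree_minpoly_of_irreducible hf hirr hθ] at h1
    have h2 := h1.restrict_scalars (R := ℤ) (by
      intro a b hab; simpa using hab)
    have h3 : (φ.toLinearMap ∘ fun i : Fin f.natDegree => x ^ (i : ℕ)) =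
        fun i : Fin f.natDegree => θ ^ (i : ℕ) := by
      funext i
      change φ (x ^ (i : ℕ)) = _
      rw [map_pow, hφx]
    rw [h3]
    exact h2
  have hsp : ⊤ ≤ Submodule.span ℤ (Set.range (fun i : Fin f.natDegree => x ^ (i : ℕ))) := by
    rintro z -
    have hz : φ z ∈ Algebra.adjoin ℤ {θ} :=
      H _ (Subtype.mem _) ((NumberField.RingOfIntegers.isIntegral z).map φ)
    rw [Algebra.adjoin_singleton_eq_range_aeval] at hz
    obtain ⟨u, hu⟩ := hz
    have h3 : z = aeval x (u %ₘ f) := by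
      apply hφinj
      rw [← aeval_algHom_apply, hφx, ← hu]
      have := congrArg (aeval θ) (modByMonic_add_div u f)
      rw [map_add, map_mul, hθ, zero_mul, add_zero] at this
      exact this.symm
    have hn : 0 < f.natDegree := by
      have := hirr.natDegree_pos
      rwa [hf.natDegree_map] at this
    rw [h3, aeval_eq_sum_range' (natDegree_modByMonic_lt u hf (by
      rintro rfl; simp at hn))]
    refine Submodule.sum_mem _ fun i hi => Submodule.smul_mem _ _ (Submodule.subset_span ?_)
    exact ⟨⟨i, Finset.mem_range.1 hi⟩, rfl⟩
  refine ⟨Module.Basis.mk hli hsp, fun i => ?_⟩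
  rw [Module.Basis.mk_apply]
  change φ (x ^ (i : ℕ)) = _
  rw [map_pow, hφx]

theorem mem_adjoin_of_isDedekindDomain {θ : ℂ} (hθ : IsIntegral ℤ θ)
    [IsDedekindDomain (Algebra.adjoin ℤ {θ})] (z : ℂ)
    (hz : z ∈ IntermediateField.adjoin ℚ {θ}) (hzi : IsIntegral ℤ z) :
    z ∈ Algebra.adjoin ℤ {θ} := by
  obtain ⟨n, q, hn, hq⟩ := exists_aeval_eq_mul_of_mem_adjoin
    (hθ.tower_top (A := ℚ)) hz
  set A := Algebra.adjoin ℤ {θ}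
  have hqA : aeval θ q ∈ A := aeval_mem_adjoin_singleton ℤ θ
  let ψ : FractionRing A →ₐ[A] ℂ := IsFractionRing.liftAlgHom (g := Algebra.ofId A ℂ)
    Subtype.val_injective
  have hψ : ∀ a : A, ψ (algebraMap A _ a) = a := fun a => ψ.commutes a
  have hψinj : Function.Injective ψ := ψ.toRingHom.injective
  set w : FractionRing A := algebraMap A _ ⟨_, hqA⟩ / (n : FractionRing A) with hw
  have hn' : (n : ℂ) ≠ 0 := by exact_mod_cast hn
  have hψw : ψ w = z := by
    rw [hw, map_div₀, map_intCast, hψ, div_eq_iff hn', mul_comm]; exact hq.symm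
  have hwi : IsIntegral ℤ w := by
    rw [← isIntegral_algHom_iff (ψ.restrictScalars ℤ) hψinj]
    change IsIntegral ℤ (ψ w)
    rwa [hψw]
  obtain ⟨a, ha⟩ := (IsIntegrallyClosed.isIntegral_iff (R := A)).1 (hwi.tower_top (A := A))
  rw [← hψw, ← ha, hψ]
  exact a.2

/-- In the power basis z is r(θ) with r of degree below deg f, so q = p r by independence of the
powers. For monic q and prime p this is a contradiction, which is how monogenicity is refuted. -/
theorem IsMonogenicPoly.leadingCoeff_dvd {f : ℤ[X]} (h : IsMonogenicPoly f) {θ : ℂ}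
    (hθ : aeval θ f = 0) {p : ℤ} (q : ℤ[X]) (hq : q.natDegree < f.natDegree) {z : ℂ}
    (hz : IsIntegral ℤ z) (hpz : (p : ℂ) * z = aeval θ q) (hp : p ≠ 0) :
    p ∣ q.leadingCoeff := by
  obtain ⟨hf, hirr, hB⟩ := h
  obtain ⟨B, hB⟩ := hB θ hθ
  have hp' : (p : ℂ) ≠ 0 := by exact_mod_cast hp
  have hzK : z ∈ IntermediateField.adjoin ℚ {θ} := by
    have h1 : z = (p : ℂ)⁻¹ * aeval θ q := by rw [← hpz, inv_mul_cancel_left₀ hp']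
    rw [h1]
    refine mul_mem (inv_mem (intCast_mem _ _)) ?_
    rw [aeval_eq_sum_range]
    refine sum_mem fun i _ => zsmul_mem (pow_mem ?_ _) _
    exact IntermediateField.mem_adjoin_simple_self ℚ θ
  let v : IntermediateField.adjoin ℚ {θ} →ₐ[ℤ] ℂ := (IntermediateField.val _).restrictScalars ℤ
  let φ : 𝓞 (IntermediateField.adjoin ℚ {θ}) →ₐ[ℤ] ℂ :=
    v.comp
      (IsScalarTower.toAlgHom ℤ (𝓞 (IntermediateField.adjoin ℚ {θ})) _)
  have hzi : IsIntegral ℤ (⟨z, hzK⟩ : IntermediateField.adjoin ℚ {θ}) :=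
    (isIntegral_algHom_iff v Subtype.val_injective).1 hz
  set w : 𝓞 (IntermediateField.adjoin ℚ {θ}) := ⟨⟨z, hzK⟩, hzi⟩
  have hw : φ w = z := rfl
  have hB' : ∀ i, φ (B i) = θ ^ (i : ℕ) := hB
  have hsum := congrArg φ (B.sum_repr w)
  rw [hw, map_sum] at hsum
  simp only [map_zsmul, hB'] at hsum
  set r : ℤ[X] := ∑ i : Fin f.natDegree, C (B.repr w i) * X ^ (i : ℕ) with hr
  have hrz : aeval θ r = z := by
    rw [← hsum, hr, map_sum]
    refine Finset.sum_congr rfl fun i _ => ?_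
    simp
  have hrd : r.natDegree < f.natDegree := by
    have hn : 0 < f.natDegree := by omega
    have : r.natDegree ≤ f.natDegree - 1 := by
      refine natDegree_sum_le_of_forall_le _ _ fun i _ => ?_
      refine (natDegree_C_mul_X_pow_le _ _).trans ?_
      have := i.2
      omega
    omega
  have hzero : C p * r - q = 0 := by
    refine eq_zero_of_aeval_eq_zero_of_natDegree_lt hf hirr hθ ?_ ?_
    · refine (natDegree_sub_le _ _).trans_lt (max_lt ?_ hq)
      exact (natDegree_C_mul_le _ _).trans_lt hrd
    · rw [map_sub, map_mul, hrz, ← hpz]; simp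
  rw [← sub_eq_zero.1 hzero, leadingCoeff_mul, leadingCoeff_C]
  exact dvd_mul_right _ _

/-! ### Monogenicity against squarefreeness of δ. -/

theorem trinomialNb_eq {N : ℕ} (b : ℕ) :
    trinomialNb N b = X ^ N - (X + C (((N : ℤ) - 1) * (N : ℤ) ^ b)) := by
  rw [trinomialNb]; ring

theorem monic_trinomialNb {N : ℕ} (hN : 1 < N) (b : ℕ) : (trinomialNb N b).Monic := by
  rw [trinomialNb_eq]
  exact monic_X_pow_sub (by rw [degree_X_add_C]; exact_mod_cast hN)

theorem natDegree_trinomialNb {N : ℕ} (hN : 1 < N) (b : ℕ) : (trinomialNb N b).natDegree = N := by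
  rw [trinomialNb_eq, natDegree_sub_eq_left_of_natDegree_lt, natDegree_X_pow]
  rwa [natDegree_X_pow, natDegree_X_add_C]

theorem aeval_trinomialNb {A : Type*} [CommRing A] (N b : ℕ) (θ : A) :
    aeval θ (trinomialNb N b) = θ ^ N - θ - ((N : A) - 1) * (N : A) ^ b := by
  simp [trinomialNb]

theorem isMonogenicPoly_of_squarefree {N b : ℕ} (hN : 1 < N) (hodd : Odd N)
    (hirr : Irreducible ((trinomialNb N b).map (Int.castRingHom ℚ)))
    (hsq : Squarefree (deltaNb N b)) : IsMonogenicPoly (trinomialNb N b) := by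
  refine ⟨monic_trinomialNb hN b, hirr, fun θ hθ => ?_⟩
  have hθi : IsIntegral ℤ θ := ⟨_, monic_trinomialNb hN b, hθ⟩
  refine exists_basis_of_integral_mem_adjoin (monic_trinomialNb hN b) hirr hθ ?_
  set A := Algebra.adjoin ℤ {θ} with hA
  have hAint : Algebra.IsIntegral ℤ A := by
    refine ⟨fun a => (isIntegral_algHom_iff A.val Subtype.val_injective).1 ?_⟩
    exact IsIntegral.of_mem_of_fg A hθi.fg_adjoin_singleton _ a.2
  have hAnoeth : IsNoetherianRing A := by
    have : Algebra.FiniteType ℤ A := Subalgebra.fg_iff_finiteType _ |>.1 ⟨{θ}, by simp [hA]⟩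
    exact Algebra.FiniteType.isNoetherianRing ℤ A
  let x : A := ⟨θ, Algebra.self_mem_adjoin_singleton ℤ θ⟩
  have hsurj : ∀ a : A, ∃ q : ℤ[X], aeval x q = a := by
    rintro ⟨a, ha⟩
    rw [hA, Algebra.adjoin_singleton_eq_range_aeval] at ha
    obtain ⟨q, hq⟩ := ha
    exact ⟨q, Subtype.val_injective ((aeval_algHom_apply A.val x q).symm.trans hq)⟩
  have hx : x ^ N - x - ((N : A) - 1) * (N : A) ^ b = 0 := by
    rw [← aeval_trinomialNb]
    apply Subtype.val_injective
    refine (aeval_algHom_apply A.val x _).symm.trans ?_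
    exact hθ
  have : IsDedekindDomain A := by
    refine isDedekindDomain_of_locally_principal fun P hP0 hP => ?_
    have h1 : P.comap (algebraMap ℤ A) ≠ ⊥ := by
      obtain ⟨y, hy, hy0⟩ := Submodule.exists_mem_ne_zero_of_ne_bot hP0
      exact Ideal.comap_ne_bot_of_integral_mem hy0 hy (Algebra.IsIntegral.isIntegral y)
    have hg := Submodule.IsPrincipal.prime_generator_of_isPrime (P.comap (algebraMap ℤ A)) h1
    have hgP := Submodule.IsPrincipal.generator_mem (P.comap (algebraMap ℤ A))
    set g := Submodule.IsPrincipal.generator (P.comap (algebraMap ℤ A))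
    have hp := Int.prime_iff_natAbs_prime.1 hg
    have hgP' : (g : A) ∈ P := by simpa using hgP
    have hpP : ((g.natAbs : ℕ) : A) ∈ P := by
      rcases Int.natAbs_eq g with h | h <;> rw [h] at hgP' <;> simpa using hgP'
    generalize g.natAbs = p at hp hpP
    exact exists_local_generator hN hodd hsq x hx hsurj P hP p hp hpP
  exact mem_adjoin_of_isDedekindDomain hθi

theorem isIntegral_of_sq_eq {θ a b z : ℂ} (hθ : IsIntegral ℤ θ)
    (ha : a ∈ Algebra.adjoin ℤ {θ}) (hb : b ∈ Algebra.adjoin ℤ {θ})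
    (h : z ^ 2 = a * z + b) : IsIntegral ℤ z := by
  set A := Algebra.adjoin ℤ {θ} with hA
  have hAint : Algebra.IsIntegral ℤ A := by
    refine ⟨fun a => (isIntegral_algHom_iff A.val Subtype.val_injective).1 ?_⟩
    exact IsIntegral.of_mem_of_fg A hθ.fg_adjoin_singleton _ a.2
  refine isIntegral_trans (A := A) z ⟨X ^ 2 - (C ⟨a, ha⟩ * X + C ⟨b, hb⟩), ?_, ?_⟩
  · refine monic_X_pow_sub (degree_linear_le.trans_lt ?_)
    norm_num
  · simp only [eval₂_sub, eval₂_add, eval₂_mul, eval₂_C, eval₂_X, eval₂_pow]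
    rw [h]
    exact sub_self _

theorem squarefree_of_isMonogenicPoly {N b : ℕ} (hN : 1 < N) (hodd : Odd N)
    (h : IsMonogenicPoly (trinomialNb N b)) : Squarefree (deltaNb N b) := by
  by_contra hsq
  obtain ⟨p, hp, e, he⟩ : ∃ p : ℕ, p.Prime ∧ (p : ℤ) * p ∣ deltaNb N b := by
    rw [← Int.squarefree_natAbs, Nat.squarefree_iff_prime_squarefree] at hsq
    push Not at hsq
    obtain ⟨p, hp, hpd⟩ := hsq
    exact ⟨p, hp, by rw [← Nat.cast_mul]; exact Int.natCast_dvd.2 hpd⟩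
  have hfm := monic_trinomialNb hN b
  have hfd := natDegree_trinomialNb hN b
  obtain ⟨θ, hθ⟩ : ∃ θ : ℂ, aeval θ (trinomialNb N b) = 0 := by
    refine IsAlgClosed.exists_aeval_eq_zero ℂ _ ?_
    rw [degree_eq_natDegree hfm.ne_zero, hfd]
    exact_mod_cast (by omega : N ≠ 0)
  have hθi : IsIntegral ℤ θ := ⟨_, hfm, hθ⟩
  have hp0 : (p : ℂ) ≠ 0 := by exact_mod_cast hp.ne_zero
  -- The relation makes z = q(θ) / p a root of the monic quadratic z ^ 2 = r(θ) z + s(θ) over ℤ[θ].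
  have key : ∀ q : ℤ[X], q.Monic → q.natDegree < N → ∀ r s : ℤ[X],
      (aeval θ q) ^ 2 = p * aeval θ r * aeval θ q + (p : ℂ) ^ 2 * aeval θ s → False := by
    intro q hq hqd r s hqrs
    have hz : IsIntegral ℤ (aeval θ q / (p : ℂ)) := by
      refine isIntegral_of_sq_eq (a := aeval θ r) (b := aeval θ s) hθi
        (aeval_mem_adjoin_singleton ℤ θ) (aeval_mem_adjoin_singleton ℤ θ) ?_
      rw [div_pow, hqrs]
      field_simp
    have := h.leadingCoeff_dvd hθ (p := (p : ℤ)) q (by rwa [hfd]) hz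
      (by simp [mul_div_cancel₀ _ hp0]) (by exact_mod_cast hp.ne_zero)
    rw [hq.leadingCoeff] at this
    exact (Nat.prime_iff_prime_int.1 hp).not_isUnit (isUnit_of_dvd_one this)
  by_cases h2 : p ∣ N - 1
  · obtain ⟨t, ht⟩ := h2
    have hNt : N = p * t + 1 := by omega
    -- Write δ = -(N - 1) S with S a geometric sum. As N ≡ 1 modulo p, S is congruent to its number
    -- of terms (b + 1)(N - 1) + 1 ≡ 1, so p ^ 2 must divide N - 1.
    have hpt : p ∣ t := by
      have hgeom := mul_geom_sum (N : ℤ) ((b + 1) * N - b)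
      set S := ∑ i ∈ Finset.range ((b + 1) * N - b), (N : ℤ) ^ i with hS
      have hNm : (N : ℤ) ≡ 1 [ZMOD p] := by
        rw [hNt]; push_cast
        exact (Int.modEq_iff_dvd.2 ⟨-t, by ring⟩)
      have hS1 : S ≡ 1 [ZMOD p] := by
        have h1 : S ≡ (((b + 1) * N - b : ℕ) : ℤ) [ZMOD p] := by
          have : (((b + 1) * N - b : ℕ) : ℤ) = ∑ i ∈ Finset.range ((b + 1) * N - b), (1 : ℤ) := by
            simp
          rw [this, hS]
          exact Int.ModEq.sum fun i _ => by simpa using hNm.pow i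
        refine h1.trans ?_
        rw [delta_exponent_eq hN.le, ht]
        push_cast
        exact (Int.modEq_iff_dvd.2 ⟨-((b + 1) * t), by ring⟩)
      have h3 : (p : ℤ) * S * t = p * (-(p * e)) := by
        have : (N : ℤ) - 1 = p * t := by rw [hNt]; push_cast; ring
        rw [deltaNb] at he
        rw [this] at hgeom
        linear_combination hgeom - he
      have h4 : S * t = p * (-e) := by
        have hp0' : (p : ℤ) ≠ 0 := by exact_mod_cast hp.ne_zero
        apply mul_left_cancel₀ hp0'
        linear_combination h3
      rcases (Nat.prime_iff_prime_int.1 hp).dvd_or_dvd ⟨_, h4⟩ with h5 | h5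
      · exfalso
        have h6 := (Int.modEq_zero_iff_dvd.2 h5).symm.trans hS1
        have h7 := (Int.modEq_iff_dvd.1 h6)
        rw [sub_zero] at h7
        exact (Nat.prime_iff_prime_int.1 hp).not_isUnit (isUnit_of_dvd_one h7)
      · exact_mod_cast h5
    obtain ⟨l, rfl⟩ := hpt
    have hl : 0 < l := by
      rcases Nat.eq_zero_or_pos l with rfl | h
      · omega
      · exact h
    have ht0 : 0 < p * l := Nat.mul_pos hp.pos hl
    obtain ⟨p', rfl⟩ : ∃ p', p = p' + 2 := ⟨p - 2, by have := hp.two_le; omega⟩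
    obtain ⟨s, hs⟩ := exists_add_pow_prime_eq hp (X ^ ((p' + 2) * l) - 1 : ℤ[X]) 1
    rw [sub_add_cancel, ← pow_mul] at hs
    have hmon : (X ^ ((p' + 2) * l) - 1 : ℤ[X]).Monic := monic_X_pow_sub_C 1 ht0.ne'
    have hdeg : (X ^ ((p' + 2) * l) - 1 : ℤ[X]).natDegree = (p' + 2) * l := natDegree_X_pow_sub_C
    -- With u = θ ^ t - 1, the equation of θ reads θ u ^ p = -p θ u s + p ^ 2 l N ^ b; multiplying
    -- by θ u ^ (p - 2) gives the quadratic relation for q(θ) = θ u ^ (p - 1).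
    refine key (X * (X ^ ((p' + 2) * l) - 1) ^ (p' + 1)) (monic_X.mul (hmon.pow _)) ?_
      (-(X * s)) (C ((l : ℤ) * (N : ℤ) ^ b) * X * (X ^ ((p' + 2) * l) - 1) ^ p') ?_
    · rw [monic_X.natDegree_mul (hmon.pow _), hmon.natDegree_pow, hdeg, natDegree_X, hNt]
      nlinarith
    · have hs' := congrArg (aeval θ) hs
      rw [aeval_trinomialNb] at hθ
      have hNs : θ ^ N = θ ^ ((p' + 2) * l * (p' + 2)) * θ := by
        rw [← pow_succ]; congr 1; rw [hNt]; ring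
      have hN1 : (N : ℂ) - 1 = ((p' : ℂ) + 2) ^ 2 * l := by rw [hNt]; push_cast; ring
      rw [hNs, hN1] at hθ
      simp only [map_add, map_sub, map_mul, map_pow, map_one, aeval_X, map_natCast, map_neg]
        at hs' ⊢
      rw [hs'] at hθ
      push_cast at hθ ⊢
      generalize θ ^ ((p' + 2) * l) - 1 = u at *
      linear_combination (θ * u ^ p') * hθ
  · obtain ⟨k, hk⟩ := trinomial_expansion hodd b (X : ℤ[X])
    have hk' : trinomialNb N b - C ((N : ℤ) ^ b * deltaNb N b) =
        (X + C ((N : ℤ) ^ (b + 1))) *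
          (-C (deltaNb N b) + k * (X + C ((N : ℤ) ^ (b + 1)))) := by
      have : trinomialNb N b = X ^ N - X - ((N : ℤ[X]) - 1) * (N : ℤ[X]) ^ b := by
        simp [trinomialNb]
      rw [this, hk]
      simp
      ring
    have hmon : (trinomialNb N b - C ((N : ℤ) ^ b * deltaNb N b)).Monic := by
      refine hfm.sub_of_left (degree_C_le.trans_lt ?_)
      rw [degree_eq_natDegree hfm.ne_zero, hfd]
      exact_mod_cast (by omega : 0 < N)
    have hqm : (-C (deltaNb N b) + k * (X + C ((N : ℤ) ^ (b + 1)))).Monic :=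
      (monic_X_add_C _).of_mul_monic_left (hk' ▸ hmon)
    -- Here q = (f - N ^ b δ) / (x + N ^ (b + 1)) = -δ + k (x + N ^ (b + 1)), so q(θ) ^ 2 = -δ q(θ)
    -- - N ^ b δ k(θ).
    refine key _ hqm ?_ (-C (p * e)) (-C ((N : ℤ) ^ b * e) * k) ?_
    · have h1 := congrArg natDegree hk'
      rw [natDegree_sub_C, hfd, (monic_X_add_C _).natDegree_mul hqm, natDegree_X_add_C] at h1
      omega
    · have h1 := congrArg (aeval θ) hk'
      rw [map_sub, hθ, he] at h1
      rw [he]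
      simp only [map_add, map_mul, map_pow, aeval_X, map_natCast, map_neg, eq_intCast] at h1 ⊢
      linear_combination (-(aeval θ k)) * h1

/-! ### Discriminants separate the fields. -/

theorem PowerBasis.norm_algebraMap_sub_gen {K L : Type*} [Field K] [Field L] [Algebra K L]
    (pb : PowerBasis K L) (c : K) :
    Algebra.norm K (algebraMap K L c - pb.gen) = (minpoly K pb.gen).eval c := by
  rw [← charpoly_leftMulMatrix pb, Matrix.eval_charpoly, Algebra.norm_eq_matrix_det pb.basis,
    map_sub, AlgHom.commutes]
  rfl

theorem discr_of_isMonogenicPoly {N b : ℕ} (hN : 1 < N) (hodd : Odd N)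
    (h : IsMonogenicPoly (trinomialNb N b)) {θ : ℂ} (hθ : aeval θ (trinomialNb N b) = 0)
    [NumberField (IntermediateField.adjoin ℚ {θ})] :
    (NumberField.discr (IntermediateField.adjoin ℚ {θ}) : ℚ) =
      (-1) ^ (N * (N - 1) / 2) * (-(((N : ℚ) - 1) ^ (N - 1) * (deltaNb N b : ℚ))) := by
  obtain ⟨hf, hirr, hB⟩ := h
  have hfd := natDegree_trinomialNb hN b
  have hθi : IsIntegral ℚ θ := IsIntegral.tower_top (R := ℤ) ⟨_, hf, hθ⟩
  set K := IntermediateField.adjoin ℚ {θ}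
  obtain ⟨B, hB⟩ := hB θ hθ
  let pb : PowerBasis ℚ K := IntermediateField.adjoin.powerBasis hθi
  set g : K := pb.gen with hg
  have hgθ : (g : ℂ) = θ := rfl
  have hmin : minpoly ℚ g = (trinomialNb N b).map (Int.castRingHom ℚ) := by
    rw [← minpoly_eq_map_of_irreducible hf hirr hθ]
    exact IntermediateField.minpoly_gen ℚ θ
  have hdim : pb.dim = (trinomialNb N b).natDegree := by
    rw [← PowerBasis.natDegree_minpoly, hmin, hf.natDegree_map]
  have hdiscr : (NumberField.discr K : ℚ) = Algebra.discr ℚ pb.basis := by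
    rw [← NumberField.discr_eq_discr K B, ← eq_intCast (algebraMap ℤ ℚ),
      ← Algebra.discr_localizationLocalization ℤ (nonZeroDivisors ℤ) K B,
      ← Algebra.discr_reindex ℚ pb.basis (finCongr hdim)]
    congr 1
    funext i
    apply Subtype.val_injective
    rw [Module.Basis.localizationLocalization_apply]
    refine (hB i).trans ?_
    simp [← hgθ, hg]
  have hnorm : ∀ c : ℚ, Algebra.norm ℚ (algebraMap ℚ K c - g) =
      c ^ N - c - ((N : ℚ) - 1) * (N : ℚ) ^ b := by
    intro c
    rw [hg, PowerBasis.norm_algebraMap_sub_gen, ← hg, hmin, ← aeval_trinomialNb]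
    exact (eval_map_algebraMap _ _)
  -- Both linear factors have the form c - g, whose norm is f(c); taking norms therefore yields the
  -- norm of f'(g), hence the discriminant.
  have hrel : aeval g (derivative (minpoly ℚ g)) * (algebraMap ℚ K 0 - g) =
      algebraMap ℚ K ((N : ℚ) - 1) * (algebraMap ℚ K (-(N : ℚ) ^ (b + 1)) - g) := by
    have h1 : aeval g (derivative (minpoly ℚ g)) = (N : K) * g ^ (N - 1) - 1 := by
      rw [hmin, trinomialNb]
      simp only [Polynomial.map_sub, Polynomial.map_pow, Polynomial.map_X, Polynomial.map_C,
        derivative_sub, derivative_X_pow, derivative_X, derivative_C]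
      simp
    have h2 : g ^ N - g - ((N : K) - 1) * (N : K) ^ b = 0 := by
      have := minpoly.aeval ℚ g
      rw [← aeval_trinomialNb, ← this, hmin]
      exact (aeval_map_algebraMap ℚ g _).symm
    have h3 : g ^ N = g ^ (N - 1) * g := by rw [← pow_succ]; congr 1; omega
    rw [h3] at h2
    rw [h1]
    simp only [map_zero, map_sub, map_natCast, map_one, map_neg, map_pow]
    linear_combination (-(N : K)) * h2
  have hfin : Module.finrank ℚ K = N := by rw [pb.finrank, hdim, hfd]
  have hnrel := congrArg (Algebra.norm ℚ) hrel
  rw [map_mul, map_mul, hnorm, hnorm, Algebra.norm_algebraMap, hfin] at hnrel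
  have hexp : (-(N : ℚ) ^ (b + 1)) ^ N - (-(N : ℚ) ^ (b + 1)) - ((N : ℚ) - 1) * (N : ℚ) ^ b =
      (N : ℚ) ^ b * (deltaNb N b : ℚ) := by
    obtain ⟨k, hk⟩ := trinomial_expansion hodd b (-(N : ℚ) ^ (b + 1))
    rw [hk]; ring
  rw [hexp, zero_pow (by omega)] at hnrel
  have hN1 : (N : ℚ) - 1 ≠ 0 := by
    have : (1 : ℚ) < N := by exact_mod_cast hN
    linarith
  have hN0 : (N : ℚ) ≠ 0 := by exact_mod_cast (by omega : N ≠ 0)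
  have hpow : ((N : ℚ) - 1) ^ N = ((N : ℚ) - 1) ^ (N - 1) * ((N : ℚ) - 1) := by
    rw [← pow_succ]; congr 1; omega
  rw [hpow] at hnrel
  rw [hdiscr, Algebra.discr_powerBasis_eq_norm, hfin]
  congr 1
  apply mul_right_cancel₀ (mul_ne_zero hN1 (pow_ne_zero b hN0))
  linear_combination -hnrel

theorem deltaNb_injective {N b b' : ℕ} (hN : 1 < N) (h : deltaNb N b = deltaNb N b') : b = b' := by
  have h1 : N ^ ((b + 1) * N - b) = N ^ ((b' + 1) * N - b') := by
    have : (N : ℤ) ^ ((b + 1) * N - b) = (N : ℤ) ^ ((b' + 1) * N - b') := by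
      rw [deltaNb, deltaNb] at h; linarith
    exact_mod_cast this
  have h2 := Nat.pow_right_injective hN h1
  rw [delta_exponent_eq hN.le, delta_exponent_eq hN.le] at h2
  have h3 := Nat.eq_of_mul_eq_mul_right (by omega : 0 < N - 1) (Nat.succ_injective h2)
  omega

theorem isEmpty_algEquiv_of_isMonogenicPoly {N b b' : ℕ} (hN : 1 < N) (hodd : Odd N)
    (hbb' : b' ≠ b) (h : IsMonogenicPoly (trinomialNb N b))
    (h' : IsMonogenicPoly (trinomialNb N b')) {θ θ' : ℂ} (hθ : aeval θ (trinomialNb N b) = 0)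
    (hθ' : aeval θ' (trinomialNb N b') = 0) :
    IsEmpty (IntermediateField.adjoin ℚ {θ} ≃ₐ[ℚ] IntermediateField.adjoin ℚ {θ'}) := by
  have hnf : ∀ {c : ℕ} {x : ℂ}, IsMonogenicPoly (trinomialNb N c) →
      aeval x (trinomialNb N c) = 0 → NumberField (IntermediateField.adjoin ℚ {x}) :=
    fun h h0 =>
      { to_finiteDimensional := IntermediateField.adjoin.finiteDimensional
          (IsIntegral.tower_top (R := ℤ) ⟨_, h.1, h0⟩) }
  have := hnf h hθ
  have := hnf h' hθ'
  refine ⟨fun e => hbb' (deltaNb_injective hN ?_)⟩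
  have h1 := congrArg (Int.cast (R := ℚ)) (NumberField.discr_eq_discr_of_algEquiv _ e)
  rw [discr_of_isMonogenicPoly hN hodd h hθ, discr_of_isMonogenicPoly hN hodd h' hθ'] at h1
  have hN1 : ((N : ℚ) - 1) ^ (N - 1) ≠ 0 := by
    have : (1 : ℚ) < N := by exact_mod_cast hN
    exact pow_ne_zero _ (by linarith)
  have h2 := mul_left_cancel₀ hN1 (neg_injective (mul_left_cancel₀ (by simp) h1))
  exact_mod_cast h2.symm

/-! ### Real parts of powers of 1 + √w. -/

theorem Zsqrtd.re_one_add_sqrtd_pow_modEq (w : ℤ) (r : ℕ) :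
    ((⟨1, 1⟩ : ℤ√w) ^ r).re ≡ 1 [ZMOD w] := by
  induction r with
  | zero => simp [Int.ModEq.refl]
  | succ r ih =>
    rw [pow_succ, Zsqrtd.re_mul]
    refine (Int.modEq_iff_dvd.2 ?_).trans ih
    exact ⟨-((⟨1, 1⟩ : ℤ√w) ^ r).im, by ring⟩

theorem Zsqrtd.re_sqrtd_pow (w : ℤ) (i : ℕ) :
    ((⟨0, 1⟩ : ℤ√w) ^ (2 * i)).re = w ^ i ∧ ((⟨0, 1⟩ : ℤ√w) ^ (2 * i + 1)).re = 0 := by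
  have h : (⟨0, 1⟩ : ℤ√w) ^ (2 * i) = ⟨w ^ i, 0⟩ := by
    induction i with
    | zero => ext <;> simp
    | succ i ih =>
      rw [mul_add, pow_add, ih]
      ext <;> simp [pow_succ]
  rw [pow_succ, h]
  simp

theorem Zsqrtd.re_one_add_sqrtd_pow (w : ℤ) (r : ℕ) :
    ((⟨1, 1⟩ : ℤ√w) ^ r).re =
      ∑ k ∈ Finset.range (r + 1), (r.choose k : ℤ) * ((⟨0, 1⟩ : ℤ√w) ^ k).re := by
  have h : (⟨1, 1⟩ : ℤ√w) = ⟨0, 1⟩ + 1 := by ext <;> simp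
  let ρ : ℤ√w →+ ℤ := { toFun := Zsqrtd.re, map_zero' := rfl, map_add' := fun _ _ => rfl }
  change ρ _ = _
  rw [h, add_pow, map_sum]
  refine Finset.sum_congr rfl fun k _ => ?_
  rw [one_pow, mul_one, mul_comm]
  change ((r.choose k : ℤ√w) * _).re = _
  simp [Zsqrtd.re_mul]

theorem two_mul_lt_pow_pred {q i : ℕ} (hq : 5 ≤ q) (hi : 2 ≤ i) : 2 * i < q ^ (i - 1) := by
  obtain ⟨i, rfl⟩ := Nat.exists_eq_add_of_le' hi
  rw [show i + 2 - 1 = i + 1 by omega]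
  refine lt_of_lt_of_le ?_ (Nat.pow_le_pow_left hq _)
  induction i with
  | zero => norm_num
  | succ i ih => rw [pow_succ]; omega

/-- Compares the i-th term of Re (1 + √w) ^ r with the first nonconstant one, so that only the
valuation of 2i(2i - 1) has to be controlled. -/
theorem choose_mul_eq {r i : ℕ} (hr : 2 ≤ r) (hi : 1 ≤ i) :
    r.choose (2 * i) * ((2 * i) * (2 * i - 1)) =
      2 * r.choose 2 * (r - 2).choose (2 * i - 2) := by
  obtain ⟨r, rfl⟩ := Nat.exists_eq_add_of_le' hr
  obtain ⟨i, rfl⟩ := Nat.exists_eq_add_of_le' hi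
  have h1 := Nat.add_one_mul_choose_eq (r + 1) (2 * i + 1)
  have h2 := Nat.add_one_mul_choose_eq r (2 * i)
  rw [Nat.choose_two_right, Nat.mul_div_cancel' (Nat.even_mul_pred_self _).two_dvd]
  simp only [show 2 * (i + 1) = 2 * i + 1 + 1 by ring, show r + 2 = r + 1 + 1 by ring,
    show 2 * i + 1 + 1 - 1 = 2 * i + 1 by omega, show 2 * i + 1 + 1 - 2 = 2 * i by omega,
    show r + 1 + 1 - 1 = r + 1 by omega, show r + 1 + 1 - 2 = r by omega]
  rw [← mul_assoc, ← h1, mul_assoc, ← h2]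
  ring

/-- The odd prime powers `q ≥ 5` dividing `w` prevent `Re (1 + √w) ^ r = 1`. -/
theorem Zsqrtd.re_one_add_sqrtd_pow_ne_one {w : ℤ} (hw : w ≠ 0) {p c : ℕ} (hp : p.Prime)
    (hc : c ≠ 0) (hq : 5 ≤ p ^ c) (hqw : ((p ^ c : ℕ) : ℤ) ∣ w) {r : ℕ} (hr : 2 ≤ r) :
    ((⟨1, 1⟩ : ℤ√w) ^ r).re ≠ 1 := by
  intro h
  have : Fact p.Prime := ⟨hp⟩
  rw [Zsqrtd.re_one_add_sqrtd_pow] at h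
  obtain ⟨r', rfl⟩ := Nat.exists_eq_add_of_le' hr
  rw [show r' + 2 + 1 = r' + 1 + 1 + 1 by ring, Finset.sum_range_succ', Finset.sum_range_succ',
    Finset.sum_range_succ'] at h
  have hC : ((r' + 2).choose 2 : ℤ) ≠ 0 := by
    exact_mod_cast (Nat.choose_pos (by omega)).ne'
  set e := padicValInt p (((r' + 2).choose 2 : ℤ) * w) with he
  have hcw : c ≤ padicValInt p w := by
    rcases (padicValInt_dvd_iff c w).1 (by exact_mod_cast hqw) with h0 | h0
    · exact absurd h0 hw
    · exact h0
  -- Every later term has valuation larger than e, that of C(r, 2) w; if the real part were 1, these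
  -- terms would have to cancel C(r, 2) w, which is impossible.
  have hterm : ∀ i, 2 ≤ i → (p : ℤ) ^ (e + 1) ∣ ((r' + 2).choose (2 * i) : ℤ) * w ^ i := by
    intro i hi
    by_cases h0 : (r' + 2).choose (2 * i) = 0
    · rw [h0]; simp
    have hD : (r' + 2 - 2).choose (2 * i - 2) ≠ 0 := by
      refine (Nat.choose_pos ?_).ne'
      by_contra hlt
      exact h0 (Nat.choose_eq_zero_of_lt (by omega))
    -- A prime power dividing a product of coprime factors divides one of them, and q ^ (i - 1) > 2i
    -- is too large for either.
    have hval : ¬ p ^ (c * (i - 1)) ∣ (2 * i) * (2 * i - 1) := by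
      rw [pow_mul]
      have hpp : IsPrimePow ((p ^ c) ^ (i - 1)) := (hp.isPrimePow.pow hc).pow (by omega)
      have hco : Nat.Coprime (2 * i) (2 * i - 1) := by
        have h1 : (2 * i - 1) + 1 = 2 * i := by omega
        rw [← h1]
        simp
      rw [hco.isPrimePow_dvd_mul hpp]
      have h2 := two_mul_lt_pow_pred hq hi
      rintro (h3 | h3)
      · have := Nat.le_of_dvd (by omega) h3; omega
      · have := Nat.le_of_dvd (by omega) h3; omega
    have hY : ((2 * i) * (2 * i - 1)) ≠ 0 := Nat.mul_ne_zero (by omega) (by omega)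
    have hval' : padicValInt p (((2 * i) * (2 * i - 1) : ℕ) : ℤ) < c * (i - 1) := by
      rw [padicValInt.of_nat]
      by_contra hle
      exact hval ((padicValNat_dvd_iff _ _).2 (Or.inr (not_lt.1 hle)))
    have heq : ((r' + 2).choose (2 * i) : ℤ) * w ^ i * (((2 * i) * (2 * i - 1) : ℕ) : ℤ) =
        ((r' + 2).choose 2 : ℤ) * w * ((2 * (r' + 2 - 2).choose (2 * i - 2) : ℕ) : ℤ) *
          w ^ (i - 1) := by
      have h1 := congrArg (Nat.cast (R := ℤ)) (choose_mul_eq (r := r' + 2) (i := i) (by omega)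
        (by omega))
      have h2 : w ^ i = w ^ (i - 1) * w := by rw [← pow_succ]; congr 1; omega
      rw [h2]
      simp only [Nat.cast_mul, Nat.cast_ofNat] at h1 ⊢
      linear_combination (w ^ (i - 1) * w) * h1
    have hpow : padicValInt p (w ^ (i - 1)) = (i - 1) * padicValInt p w := by
      simp only [padicValInt, Int.natAbs_pow]
      exact padicValNat.pow _ _
    have hv := congrArg (padicValInt p) heq
    have h0' : ((r' + 2).choose (2 * i) : ℤ) ≠ 0 := by exact_mod_cast h0
    have hD' : ((2 * (r' + 2 - 2).choose (2 * i - 2) : ℕ) : ℤ) ≠ 0 := by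
      exact_mod_cast Nat.mul_ne_zero two_ne_zero hD
    have hY' : (((2 * i) * (2 * i - 1) : ℕ) : ℤ) ≠ 0 := by exact_mod_cast hY
    rw [padicValInt.mul (mul_ne_zero h0' (pow_ne_zero _ hw)) hY',
      padicValInt.mul (mul_ne_zero (mul_ne_zero hC hw) hD') (pow_ne_zero _ hw),
      padicValInt.mul (mul_ne_zero hC hw) hD', ← he, hpow] at hv
    refine (padicValInt_dvd_iff _ _).2 (Or.inr ?_)
    have : c * (i - 1) ≤ (i - 1) * padicValInt p w := by
      rw [mul_comm]; exact Nat.mul_le_mul_left _ hcw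
    omega
  have hrest : (p : ℤ) ^ (e + 1) ∣ ∑ k ∈ Finset.range r', ((r' + 2).choose (k + 1 + 1 + 1) : ℤ) *
      ((⟨0, 1⟩ : ℤ√w) ^ (k + 1 + 1 + 1)).re := by
    refine Finset.dvd_sum fun k _ => ?_
    rcases Nat.even_or_odd' (k + 1 + 1 + 1) with ⟨i, hi | hi⟩
    · rw [hi, (Zsqrtd.re_sqrtd_pow w i).1]
      exact hterm i (by omega)
    · rw [hi, (Zsqrtd.re_sqrtd_pow w i).2]
      simp
  have hlast : (p : ℤ) ^ (e + 1) ∣ ((r' + 2).choose 2 : ℤ) * w := by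
    have h1 := (Zsqrtd.re_sqrtd_pow w 1).1
    rw [mul_one, pow_one] at h1
    simp only [zero_add, one_add_one_eq_two, pow_one, Nat.choose_zero_right, pow_zero] at h
    rw [h1] at h
    have h3 : ((r' + 2).choose 2 : ℤ) * w = -∑ k ∈ Finset.range r',
      ((r' + 2).choose (k + 1 + 1 + 1) : ℤ) * ((⟨0, 1⟩ : ℤ√w) ^ (k + 1 + 1 + 1)).re := by
      simp at h
      linarith
    rw [h3]
    exact hrest.neg_right
  rcases (padicValInt_dvd_iff _ _).1 hlast with h0 | h0
  · exact mul_ne_zero hC hw h0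
  · omega

/-- The base is (1 + √-6) ^ 4. Squaring raises a by one and an odd exponent resets it to 0, so the
induction on k halves. Because y is odd, the contribution of the imaginary part to Re (1 + √-6) ^
(4k + 1) cannot cancel 2 ^ (a + 4) x. -/
theorem Zsqrtd.exists_pow_eq_neg_six {k : ℕ} (hk : k ≠ 0) :
    ∃ (a : ℕ) (x y : ℤ), Odd y ∧
      (⟨1, -20⟩ : ℤ√(-6)) ^ k = ⟨1 + 2 ^ (a + 4) * x, 2 ^ (a + 2) * y⟩ := by
  induction k using Nat.strong_induction_on with
  | _ k ih =>
    have hsq : ∀ j : ℕ, j < k → j ≠ 0 → ∃ (a : ℕ) (x y : ℤ), Odd y ∧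
        (⟨1, -20⟩ : ℤ√(-6)) ^ (2 * j) = ⟨1 + 2 ^ (a + 1 + 4) * x, 2 ^ (a + 1 + 2) * y⟩ := by
      intro j hj hj0
      obtain ⟨a, x, y, hy, h⟩ := ih j hj hj0
      refine ⟨a, x + 2 ^ (a + 3) * x ^ 2 - 3 * 2 ^ a * y ^ 2, y + 2 ^ (a + 4) * x * y, ?_, ?_⟩
      · refine hy.add_even ⟨2 ^ (a + 3) * x * y, ?_⟩
        ring
      · rw [mul_comm, pow_mul, h, sq]
        ext
        · simp only [Zsqrtd.re_mul]; ring
        · simp only [Zsqrtd.im_mul]; ring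
    rcases Nat.even_or_odd' k with ⟨j, rfl | rfl⟩
    · obtain ⟨a, x, y, hy, h⟩ := hsq j (by omega) (by omega)
      exact ⟨a + 1, x, y, hy, h⟩
    · rcases Nat.eq_zero_or_pos j with rfl | hj
      · exact ⟨0, 0, -5, by decide, by ext <;> norm_num⟩
      · obtain ⟨a, x, y, hy, h⟩ := hsq j (by omega) (by omega)
        refine ⟨0, 2 ^ (a + 1) * (x + 30 * y), 2 ^ (a + 1) * y - 5 - 2 ^ (a + 3) * 20 * x, ?_, ?_⟩
        · exact ⟨2 ^ a * y - 3 - 2 ^ (a + 2) * 20 * x, by ring⟩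
        · rw [pow_succ, h]
          ext
          · simp only [Zsqrtd.re_mul]; ring
          · simp only [Zsqrtd.im_mul]; ring

theorem Zsqrtd.re_pow_ne_one_neg_six {r : ℕ} (hr : Odd r) (hr1 : r ≠ 1) :
    ((⟨1, 1⟩ : ℤ√(-6)) ^ r).re ≠ 1 := by
  have h4 : (⟨1, 1⟩ : ℤ√(-6)) ^ 4 = ⟨1, -20⟩ := by decide
  obtain ⟨k, hk⟩ : ∃ k, r = 4 * k + 1 ∨ r = 4 * k + 3 := ⟨r / 4, by
    have := Nat.odd_iff.1 hr; omega⟩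
  rcases Nat.eq_zero_or_pos k with rfl | hk0
  · rcases hk with rfl | rfl
    · exact absurd rfl hr1
    · decide
  obtain ⟨a, x, y, ⟨z, rfl⟩, h⟩ := Zsqrtd.exists_pow_eq_neg_six hk0.ne'
  rcases hk with rfl | rfl
  · rw [pow_add, pow_mul, h4, h, pow_one, Zsqrtd.re_mul]
    intro h0
    have h1 : (2 : ℤ) ^ (a + 2) * (2 * (2 * x - 6 * z - 3)) = 0 := by
      simp only at h0
      linear_combination h0
    rcases mul_eq_zero.1 h1 with h2 | h2
    · exact absurd h2 (by positivity)
    · omega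
  · have h3 : (⟨1, 1⟩ : ℤ√(-6)) ^ 3 = ⟨-17, -3⟩ := by decide
    rw [pow_add, pow_mul, h4, h, h3, Zsqrtd.re_mul]
    simp only [pow_add]
    generalize (2 : ℤ) ^ a = A
    intro h0
    have h1 : 4 * (-68 * (A * x) + 18 * (A * (2 * z + 1))) = 18 := by linear_combination h0
    omega

/-- The base is (1 + √-2) ^ 8. Now both corrections to the real part have order 2 ^ (a + 4), so
oddness of y is not enough: x ≡ y + 2 modulo 4 is carried along to keep x - y and x + 11 y nonzero.
-/
theorem Zsqrtd.exists_pow_eq_neg_two {k : ℕ} (hk : k ≠ 0) :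
    ∃ (a : ℕ) (x y u : ℤ), Odd y ∧ x = y + 4 * u + 2 ∧
      (⟨17, 56⟩ : ℤ√(-2)) ^ k = ⟨1 + 2 ^ (a + 4) * x, 2 ^ (a + 3) * y⟩ := by
  induction k using Nat.strong_induction_on with
  | _ k ih =>
    have hsq : ∀ j : ℕ, j < k → j ≠ 0 → ∃ (a : ℕ) (x y u : ℤ), Odd y ∧ x = y + 4 * u + 2 ∧
        (⟨17, 56⟩ : ℤ√(-2)) ^ (2 * j) = ⟨1 + 2 ^ (a + 1 + 4) * x, 2 ^ (a + 1 + 3) * y⟩ := by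
      intro j hj hj0
      obtain ⟨a, x, y, u, hy, hx, h⟩ := ih j hj hj0
      refine ⟨a, x + 2 ^ (a + 3) * x ^ 2 - 2 ^ (a + 2) * y ^ 2, y + 2 ^ (a + 4) * x * y,
        u + 2 ^ (a + 1) * x ^ 2 - 2 ^ a * y ^ 2 - 2 ^ (a + 2) * x * y, ?_, ?_, ?_⟩
      · refine hy.add_even ⟨2 ^ (a + 3) * x * y, ?_⟩
        ring
      · linear_combination hx
      · rw [mul_comm, pow_mul, h, sq]
        ext
        · simp only [Zsqrtd.re_mul]; ring
        · simp only [Zsqrtd.im_mul]; ring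
    rcases Nat.even_or_odd' k with ⟨j, rfl | rfl⟩
    · obtain ⟨a, x, y, u, hy, hx, h⟩ := hsq j (by omega) (by omega)
      exact ⟨a + 1, x, y, u, hy, hx, h⟩
    · rcases Nat.eq_zero_or_pos j with rfl | hj
      · exact ⟨0, 1, 7, -2, by decide, by norm_num, by ext <;> norm_num⟩
      · obtain ⟨a, x, y, u, hy, hx, h⟩ := hsq j (by omega) (by omega)
        refine ⟨0, 1 + 2 ^ a * 34 * x - 2 ^ (a + 4) * 7 * y,
          7 + 2 ^ (a + 5) * 7 * x + 2 ^ a * 34 * y,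
          -2 + 2 ^ a * 17 * (2 * u + 1) - 2 ^ (a + 2) * 7 * y - 2 ^ (a + 3) * 7 * x, ?_, ?_, ?_⟩
        · exact ⟨3 + 2 ^ (a + 4) * 7 * x + 2 ^ a * 17 * y, by ring⟩
        · linear_combination (2 ^ a * 34) * hx
        · rw [pow_succ, h]
          ext
          · simp only [Zsqrtd.re_mul]; ring
          · simp only [Zsqrtd.im_mul]; ring

theorem Zsqrtd.exists_pow_four_eq_neg_two (k : ℕ) :
    ∃ x y : ℤ, (⟨-7, -4⟩ : ℤ√(-2)) ^ k = ⟨1 + 8 * x, 4 * y⟩ := by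
  induction k with
  | zero => exact ⟨0, 0, rfl⟩
  | succ k ih =>
    obtain ⟨x, y, h⟩ := ih
    refine ⟨-1 - 7 * x + 4 * y, -1 - 8 * x - 7 * y, ?_⟩
    rw [pow_succ, h]
    ext
    · simp only [Zsqrtd.re_mul]; ring
    · simp only [Zsqrtd.im_mul]; ring

theorem Zsqrtd.eq_five_of_re_pow_neg_two {r : ℕ} (hr : Odd r) (hr1 : r ≠ 1)
    (h : ((⟨1, 1⟩ : ℤ√(-2)) ^ r).re = 1 ∨ ((⟨1, 1⟩ : ℤ√(-2)) ^ r).re = -1) : r = 5 := by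
  have h4 : (⟨1, 1⟩ : ℤ√(-2)) ^ 4 = ⟨-7, -4⟩ := by decide
  obtain ⟨k, hk⟩ : ∃ k, r = 4 * k + 1 ∨ r = 4 * k + 3 := ⟨r / 4, by
    have := Nat.odd_iff.1 hr; omega⟩
  obtain ⟨x, y, hxy⟩ := Zsqrtd.exists_pow_four_eq_neg_two k
  rcases hk with rfl | rfl
  · have h1 : ((⟨1, 1⟩ : ℤ√(-2)) ^ (4 * k + 1)).re = 1 := by
      refine h.resolve_right ?_
      rw [pow_add, pow_mul, h4, hxy, pow_one, Zsqrtd.re_mul]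
      simp only
      omega
    clear h hxy
    have h8 : (⟨1, 1⟩ : ℤ√(-2)) ^ 8 = ⟨17, 56⟩ := by decide
    rcases Nat.even_or_odd' k with ⟨j, rfl | rfl⟩
    · exfalso
      obtain ⟨a, x, y, u, hy, rfl, h⟩ := Zsqrtd.exists_pow_eq_neg_two (k := j) (by omega)
      rw [show 4 * (2 * j) + 1 = 8 * j + 1 by ring, pow_add, pow_mul, h8, h, pow_one,
        Zsqrtd.re_mul] at h1
      have h2 : (2 : ℤ) ^ (a + 4) * (4 * u + 2) = 0 := by
        simp only at h1
        linear_combination h1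
      rcases mul_eq_zero.1 h2 with h2 | h2
      · exact absurd h2 (by positivity)
      · omega
    · rcases Nat.eq_zero_or_pos j with rfl | hj
      · rfl
      exfalso
      obtain ⟨a, x, y, u, hy, rfl, h⟩ := Zsqrtd.exists_pow_eq_neg_two (k := j) (by omega)
      have h5 : (⟨1, 1⟩ : ℤ√(-2)) ^ 5 = ⟨1, -11⟩ := by decide
      rw [show 4 * (2 * j + 1) + 1 = 8 * j + 5 by ring, pow_add, pow_mul, h8, h, h5,
        Zsqrtd.re_mul] at h1
      have h2 : (2 : ℤ) ^ (a + 4) * (12 * y + 4 * u + 2) = 0 := by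
        simp only at h1
        linear_combination h1
      rcases mul_eq_zero.1 h2 with h2 | h2
      · exact absurd h2 (by positivity)
      · omega
  · exfalso
    have h3 : (⟨1, 1⟩ : ℤ√(-2)) ^ 3 = ⟨-5, 1⟩ := by decide
    rw [pow_add, pow_mul, h4, hxy, h3, Zsqrtd.re_mul] at h
    simp only at h
    omega

/-- If `w < 0` and `w ≡ 2 (mod 4)`, the only odd `r > 1` for which `(1 + √w) ^ r` has real part
`±1` comes from `(1 + √-2) ^ 5 = 1 - 11 √-2`. -/
theorem Zsqrtd.eq_of_re_one_add_sqrtd_pow {w : ℤ} (hw : w < 0) (hw4 : w % 4 = 2) {r : ℕ}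
    (hr : Odd r) (hr1 : r ≠ 1)
    (h : ((⟨1, 1⟩ : ℤ√w) ^ r).re = 1 ∨ ((⟨1, 1⟩ : ℤ√w) ^ r).re = -1) : w = -2 ∧ r = 5 := by
  by_cases hw2 : w = -2
  · subst hw2
    exact ⟨rfl, Zsqrtd.eq_five_of_re_pow_neg_two hr hr1 h⟩
  exfalso
  have h1 : ((⟨1, 1⟩ : ℤ√w) ^ r).re = 1 := by
    refine h.resolve_right fun h0 => ?_
    have h2 := Int.modEq_iff_dvd.1 (Zsqrtd.re_one_add_sqrtd_pow_modEq w r)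
    rw [h0] at h2
    have h3 := Int.le_of_dvd (by norm_num) ((neg_dvd).2 h2)
    omega
  by_cases hw6 : w = -6
  · subst hw6
    exact Zsqrtd.re_pow_ne_one_neg_six hr hr1 h1
  -- Now v is odd and different from 1 and 3, so it is divisible by 9 or by a prime at least 5.
  obtain ⟨v, rfl⟩ : ∃ v : ℕ, w = -2 * (v : ℤ) := ⟨(w / -2).toNat, by omega⟩
  have hr2 : 2 ≤ r := by rcases hr with ⟨k, rfl⟩; omega
  by_cases h9 : 9 ∣ v
  · obtain ⟨z, rfl⟩ := h9
    exact Zsqrtd.re_one_add_sqrtd_pow_ne_one hw.ne Nat.prime_three two_ne_zero (by norm_num)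
      ⟨-2 * z, by push_cast; ring⟩ hr2 h1
  obtain ⟨p, hp, hpv, hp5⟩ : ∃ p : ℕ, p.Prime ∧ p ∣ v ∧ 5 ≤ p := by
    by_cases h3 : 3 ∣ v
    · obtain ⟨z, rfl⟩ := h3
      obtain ⟨p, hp, hpz⟩ := Nat.exists_prime_and_dvd (n := z) (by rintro rfl; omega)
      refine ⟨p, hp, hpz.mul_left _, ?_⟩
      have := hp.two_le
      by_contra hlt
      interval_cases p
      · omega
      · omega
      · exact absurd hp (by norm_num)
    · obtain ⟨p, hp, hpz⟩ := Nat.exists_prime_and_dvd (n := v) (by rintro rfl; omega)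
      refine ⟨p, hp, hpz, ?_⟩
      have := hp.two_le
      by_contra hlt
      interval_cases p
      · omega
      · omega
      · exact absurd hp (by norm_num)
  obtain ⟨z, rfl⟩ := hpv
  exact Zsqrtd.re_one_add_sqrtd_pow_ne_one hw.ne hp one_ne_zero (by simpa using hp5)
    ⟨-2 * z, by push_cast; ring⟩ hr2 h1

/-! ### Integers and units of ℚ(√d) for negative d ≡ 2 (mod 4). -/

/-- The squared denominator of z divides d, hence is odd since 4 ∤ d. This replaces a full
description of the integers of ℚ(√d), as d need not be squarefree. -/
theorem even_of_mul_sq_eq {d c : ℤ} (hd : d % 4 = 2) {z : ℚ} (h : (d : ℚ) * z ^ 2 = c) :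
    Even c := by
  have hz : (z.den : ℚ) ≠ 0 := by exact_mod_cast z.den_nz
  have h1 : d * z.num ^ 2 = c * (z.den : ℤ) ^ 2 := by
    have : (d : ℚ) * z.num ^ 2 = c * (z.den : ℚ) ^ 2 := by
      rw [← h]
      nth_rw 2 [← Rat.num_div_den z]
      field_simp
    exact_mod_cast this
  have hco : IsCoprime ((z.den : ℤ) ^ 2) (z.num ^ 2) :=
    IsCoprime.pow (Int.isCoprime_iff_gcd_eq_one.2 (by
      rw [Int.gcd_eq_natAbs_gcd_natAbs, Int.natAbs_natCast]; exact z.reduced.symm))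
  have hdvd : (z.den : ℤ) ^ 2 ∣ d := hco.dvd_of_dvd_mul_right (Dvd.intro_left c h1.symm)
  have hden : Odd (z.den : ℤ) := by
    by_contra he
    obtain ⟨k, hk⟩ := Int.not_odd_iff_even.1 he
    obtain ⟨l, hl⟩ := hdvd
    rw [hk] at hl
    have : d = 4 * (k ^ 2 * l) := by rw [hl]; ring
    omega
  have heven : Even (c * (z.den : ℤ) ^ 2) := by
    rw [← h1]
    exact (Int.even_iff.2 (by omega)).mul_right _
  rcases Int.even_mul.1 heven with h2 | h2
  · exact h2
  · exact absurd h2 (Int.not_even_iff_odd.2 hden.pow)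

theorem exists_eq_add_mul_of_mem_adjoin {d : ℤ} {s : ℂ} (hs : s ^ 2 = d) {z : ℂ}
    (hz : z ∈ IntermediateField.adjoin ℚ {s}) : ∃ x y : ℚ, z = x + y * s := by
  have hsi : IsIntegral ℚ s := ⟨X ^ 2 - C (d : ℚ), monic_X_pow_sub_C _ two_ne_zero, by
    rw [eval₂_sub, eval₂_pow, eval₂_X, eval₂_C, hs]; simp⟩
  have hz' : z ∈ Algebra.adjoin ℚ {s} := by
    rw [← IntermediateField.adjoin_simple_toSubalgebra_of_isAlgebraic hsi.isAlgebraic]; exact hz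
  clear hz
  induction hz' using Algebra.adjoin_induction with
  | mem x hx => exact ⟨0, 1, by rw [Set.mem_singleton_iff.1 hx]; simp⟩
  | algebraMap q => exact ⟨q, 0, by simp⟩
  | add a b _ _ ha hb =>
    obtain ⟨x, y, rfl⟩ := ha
    obtain ⟨x', y', rfl⟩ := hb
    exact ⟨x + x', y + y', by push_cast; ring⟩
  | mul a b _ _ ha hb =>
    obtain ⟨x, y, rfl⟩ := ha
    obtain ⟨x', y', rfl⟩ := hb
    refine ⟨x * x' + y * y' * d, x * y' + x' * y, ?_⟩
    push_cast
    linear_combination (y * y' : ℂ) * hs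

theorem Complex.re_eq_zero_of_sq_eq {d : ℤ} (hd : d < 0) {s : ℂ} (hs : s ^ 2 = d) : s.re = 0 := by
  have h1 := congrArg Complex.re hs
  have h2 := congrArg Complex.im hs
  simp only [sq, Complex.mul_re, Complex.mul_im, Complex.intCast_re, Complex.intCast_im] at h1 h2
  have hd' : (d : ℝ) < 0 := by exact_mod_cast hd
  by_contra h0
  have h3 : s.im = 0 := by
    have : s.re * s.im = 0 := by linarith
    exact (mul_eq_zero.1 this).resolve_left h0
  rw [h3] at h1
  nlinarith [mul_self_nonneg s.re]

theorem exists_int_of_isIntegral_rat {x : ℚ} (h : IsIntegral ℤ (x : ℂ)) : ∃ n : ℤ, x = n := by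
  have h1 : IsIntegral ℤ x := by
    have := (isIntegral_algHom_iff ((Algebra.ofId ℚ ℂ).restrictScalars ℤ)
      (algebraMap ℚ ℂ).injective (x := x)).1
    exact this (by simpa using h)
  obtain ⟨n, hn⟩ := IsIntegrallyClosed.isIntegral_iff.1 h1
  exact ⟨n, by simpa using hn.symm⟩

/-- Integers of `ℚ(√d)`, for a negative `d ≡ 2 (mod 4)`: the rational part and the norm are rational
integers. -/
theorem exists_int_add_of_isIntegral {d : ℤ} (hd : d < 0) (hd4 : d % 4 = 2) {s : ℂ}
    (hs : s ^ 2 = d) {z : ℂ} (hz : z ∈ IntermediateField.adjoin ℚ {s}) (hzi : IsIntegral ℤ z) :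
    ∃ (x n : ℤ) (y : ℚ), z = x + y * s ∧ (x : ℚ) ^ 2 - d * y ^ 2 = n ∧
      Complex.normSq z = n := by
  obtain ⟨x, y, rfl⟩ := exists_eq_add_mul_of_mem_adjoin hs hz
  have hsre := Complex.re_eq_zero_of_sq_eq hd hs
  have hconj : (starRingEnd ℂ) ((x : ℂ) + y * s) = x - y * s := by
    have : (starRingEnd ℂ) s = -s := by
      apply Complex.ext <;> simp [hsre]
    simp only [map_add, map_mul, map_ratCast, this]
    ring
  have hci : IsIntegral ℤ ((x : ℂ) - y * s) := by
    rw [← hconj]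
    exact hzi.map (((Complex.conjAe : ℂ →ₐ[ℝ] ℂ)).restrictScalars ℤ)
  obtain ⟨T, hT⟩ := exists_int_of_isIntegral_rat (x := 2 * x) (by
    have h : ((2 * x : ℚ) : ℂ) = (x + y * s) + (x - y * s) := by push_cast; ring
    rw [h]
    exact hzi.add hci)
  obtain ⟨n, hn⟩ := exists_int_of_isIntegral_rat (x := x ^ 2 - d * y ^ 2) (by
    have h : ((x ^ 2 - d * y ^ 2 : ℚ) : ℂ) = (x + y * s) * (x - y * s) := by
      push_cast; linear_combination (y : ℂ) ^ 2 * hs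
    rw [h]
    exact hzi.mul hci)
  -- With T = 2x the trace, d (2y) ^ 2 = T ^ 2 - 4n; evenness makes T even, so x is an integer.
  have heven : Even (T ^ 2 - 4 * n) := by
    refine even_of_mul_sq_eq hd4 (z := 2 * y) ?_
    push_cast
    rw [← hT, ← hn]; ring
  obtain ⟨X, rfl⟩ : Even T := by
    have h1 : Even (T ^ 2) := by
      have := heven.add (⟨2 * n, by ring⟩ : Even (4 * n))
      simpa using this
    exact (Int.even_pow.1 h1).1
  have hxX : x = X := by push_cast at hT; linarith
  subst hxX
  refine ⟨X, n, y, by simp, hn, ?_⟩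
  have h1 := Complex.mul_conj ((X : ℚ) + y * s : ℂ)
  rw [hconj] at h1
  have h2 : ((X : ℚ) + y * s : ℂ) * ((X : ℚ) - y * s) = n := by
    have := congrArg (Rat.cast (K := ℂ)) hn
    push_cast at this ⊢
    linear_combination this - (y : ℂ) ^ 2 * hs
  rw [h2] at h1
  exact_mod_cast h1.symm

/-- A unit has norm x ^ 2 - d y ^ 2 = 1, so x ^ 2 ≤ 1, and x is odd because x ^ 2 - 1 = d y ^ 2 is
even; hence y = 0. -/
theorem eq_one_or_neg_one_of_isIntegral {d : ℤ} (hd : d < 0) (hd4 : d % 4 = 2) {s : ℂ}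
    (hs : s ^ 2 = d) {z z' : ℂ} (hz : z ∈ IntermediateField.adjoin ℚ {s}) (hzi : IsIntegral ℤ z)
    (hz' : z' ∈ IntermediateField.adjoin ℚ {s}) (hzi' : IsIntegral ℤ z') (h : z * z' = 1) :
    z = 1 ∨ z = -1 := by
  obtain ⟨x, n, y, rfl, hn, hnorm⟩ := exists_int_add_of_isIntegral hd hd4 hs hz hzi
  obtain ⟨x', n', y', rfl, hn', hnorm'⟩ := exists_int_add_of_isIntegral hd hd4 hs hz' hzi'
  have h1 := congrArg Complex.normSq h
  rw [map_mul, hnorm, hnorm', map_one] at h1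
  have h2 : n * n' = 1 := by exact_mod_cast h1
  have hn0 : 0 ≤ n := by
    have := Complex.normSq_nonneg ((x : ℂ) + y * s)
    rw [hnorm] at this
    exact_mod_cast this
  have hn1 : n = 1 := by
    rcases Int.eq_one_or_neg_one_of_mul_eq_one h2 with h | h <;> omega
  subst hn1
  have hd' : (d : ℚ) < 0 := by exact_mod_cast hd
  have hev : Even (x ^ 2 - 1) := by
    refine even_of_mul_sq_eq hd4 (z := y) ?_
    push_cast at hn ⊢
    linarith
  have hx1 : x ^ 2 ≤ 1 := by
    have : (x : ℚ) ^ 2 ≤ 1 := by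
      push_cast at hn
      nlinarith [sq_nonneg y]
    exact_mod_cast this
  have hx2 : x ^ 2 = 1 := by
    have := sq_nonneg x
    have h3 : x ^ 2 ≠ 0 := by
      intro h0; rw [h0] at hev; exact absurd hev (by decide)
    omega
  have hy : y = 0 := by
    have h3 : (x : ℚ) ^ 2 = 1 := by exact_mod_cast hx2
    rw [h3] at hn
    have : (d : ℚ) * y ^ 2 = 0 := by push_cast at hn; linarith
    simpa [hd'.ne] using this
  subst hy
  rcases Int.eq_one_or_neg_one_of_mul_eq_one (sq x ▸ hx2) with h | h
  · left; simp [h]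
  · right; simp [h]

/-! ### Excluding r-th powers, and the ideal class of exact order. -/

theorem Zsqrtd.dvd_re_pow (w x : ℤ) {r : ℕ} (hr : Odd r) : x ∣ ((⟨x, 1⟩ : ℤ√w) ^ r).re := by
  obtain ⟨k, rfl⟩ := hr
  have h : x ∣ ((⟨x, 1⟩ : ℤ√w) ^ (2 * k)).im := by
    rw [pow_mul]
    induction k with
    | zero => simp
    | succ k ih =>
      rw [pow_succ, Zsqrtd.im_mul]
      refine dvd_add (Dvd.dvd.mul_left ?_ _) (Dvd.dvd.mul_right ih _)
      exact ⟨2, by simp [sq]; ring⟩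
  rw [pow_succ, Zsqrtd.re_mul]
  exact dvd_add (Dvd.intro_left _ rfl) ((h.mul_left w).mul_right _)

theorem Zsqrtd.re_pow_eq {w x : ℤ} {t : ℂ} (ht : t ^ 2 = w) (htre : t.re = 0) (r : ℕ) :
    ((((⟨x, 1⟩ : ℤ√w) ^ r).re : ℤ) : ℝ) = ((x + t) ^ r).re := by
  have h := map_pow (Zsqrtd.lift (⟨t, by rw [← sq, ht]⟩ : { r : ℂ // r * r = (w : ℂ) }))
    ⟨x, 1⟩ r
  simp only [Zsqrtd.lift_apply_apply, Int.cast_one, one_mul] at h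
  rw [← h]
  simp [htre]

/-- `±(1 + √(1 - N ^ (r j)))` is an `r`-th power in `ℚ(√(1 - N ^ (r j)))` only for
`(1 + √-2) ^ 5 = 1 - √-242`. -/
theorem eq_three_of_pow_eq {N r j : ℕ} (hN : N % 4 = 3) (hj : Odd j) (hr : Odd r) (hr1 : r ≠ 1)
    {d : ℤ} (hd : d = 1 - (N : ℤ) ^ (j * r)) (hd0 : d < 0) (hd4 : d % 4 = 2) {s : ℂ}
    (hs : s ^ 2 = d) {α : ℂ} (hα : α ∈ IntermediateField.adjoin ℚ {s}) (hαi : IsIntegral ℤ α)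
    (h : α ^ r = 1 + s ∨ α ^ r = -(1 + s)) : N ^ j = 3 ∧ r = 5 := by
  obtain ⟨x, n, y, rfl, hn, hnorm⟩ := exists_int_add_of_isIntegral hd0 hd4 hs hα hαi
  have hsre := Complex.re_eq_zero_of_sq_eq hd0 hs
  have hr0 : r ≠ 0 := by rintro rfl; exact absurd hr (by decide)
  have hn0 : 0 ≤ n := by
    have := Complex.normSq_nonneg ((x : ℂ) + y * s)
    rw [hnorm] at this
    exact_mod_cast this
  have hs1 : Complex.normSq (1 + s) = (N : ℝ) ^ (j * r) := by
    have h1 := congrArg Complex.re hs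
    simp only [sq, Complex.mul_re, Complex.intCast_re, hsre] at h1
    rw [hd] at h1
    push_cast at h1
    simp only [Complex.normSq_apply, Complex.add_re, Complex.add_im, Complex.one_re,
      Complex.one_im, hsre]
    linarith
  -- The norm of 1 + s is 1 - d = N ^ (j r), so the norm of α is its r-th root.
  have hnN : n = (N : ℤ) ^ j := by
    have h1 : (n : ℝ) ^ r = (N : ℝ) ^ (j * r) := by
      rw [← hnorm, ← map_pow, ← hs1]
      rcases h with h | h <;> rw [h]
      rw [Complex.normSq_neg]
    have h2 : n ^ r = ((N : ℤ) ^ j) ^ r := by rw [← pow_mul]; exact_mod_cast h1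
    exact (pow_left_inj₀ hn0 (by positivity) hr0).1 h2
  set t : ℂ := y * s with ht
  set w : ℤ := x ^ 2 - n with hw
  have htw : t ^ 2 = w := by
    have := congrArg (Rat.cast (K := ℂ)) hn
    push_cast at this
    rw [ht, hw, mul_pow, hs]; push_cast; linear_combination -this
  have htre : t.re = 0 := by
    rw [ht, Complex.mul_re]; simp [hsre]
  have hre : ((x + t : ℂ) ^ r).re = 1 ∨ ((x + t : ℂ) ^ r).re = -1 := by
    rcases h with h | h <;> rw [h] <;> simp [hsre]
  have hx : x = 1 ∨ x = -1 := by
    have h1 := Zsqrtd.dvd_re_pow w x hr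
    rw [← Zsqrtd.re_pow_eq htw htre] at hre
    apply Int.isUnit_iff.1
    rcases hre with h2 | h2
    · rw [show ((⟨x, 1⟩ : ℤ√w) ^ r).re = 1 by exact_mod_cast h2] at h1
      exact isUnit_of_dvd_one h1
    · rw [show ((⟨x, 1⟩ : ℤ√w) ^ r).re = -1 by exact_mod_cast h2] at h1
      exact isUnit_of_dvd_one ((dvd_neg).1 h1)
  have hfin : ((⟨1, 1⟩ : ℤ√w) ^ r).re = 1 ∨ ((⟨1, 1⟩ : ℤ√w) ^ r).re = -1 := by
    rcases hx with hx | hx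
    · rw [hx, ← Zsqrtd.re_pow_eq htw htre] at hre
      exact_mod_cast hre
    -- The case x = -1 reduces to x = 1 by negating α and replacing t with -t, which has the same
    -- square w.
    · have h1 : ((x : ℂ) + t) = -(((1 : ℤ) : ℂ) + -t) := by rw [hx]; push_cast; ring
      rw [h1, hr.neg_pow, Complex.neg_re, ← Zsqrtd.re_pow_eq (w := w) (by rw [neg_sq, htw])
        (by simp [htre])] at hre
      rw [neg_eq_iff_eq_neg, neg_inj] at hre
      exact_mod_cast hre.symm
  have hN4 : ((N : ℤ) ^ j) % 4 = 3 := by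
    have h1 : (N : ℤ) ≡ -1 [ZMOD 4] := by
      refine Int.modEq_iff_dvd.2 ?_
      omega
    have h2 := h1.pow j
    rw [hj.neg_one_pow] at h2
    have := Int.modEq_iff_dvd.1 h2
    omega
  have hx2 : x ^ 2 = 1 := by rcases hx with rfl | rfl <;> norm_num
  have hpos : 0 ≤ (N : ℤ) ^ j := by positivity
  obtain ⟨h1, h2⟩ := Zsqrtd.eq_of_re_one_add_sqrtd_pow (w := w) (by omega) (by omega) hr hr1 hfin
  refine ⟨?_, h2⟩
  have : (N : ℤ) ^ j = 3 := by omega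
  exact_mod_cast this

theorem finrank_adjoin_eq_two {d : ℤ} (hd : d < 0) {s : ℂ} (hs : s ^ 2 = d) :
    Module.finrank ℚ (IntermediateField.adjoin ℚ {s}) = 2 := by
  have hmon : (X ^ 2 - C (d : ℚ)).Monic := monic_X_pow_sub_C _ two_ne_zero
  have hev : aeval s (X ^ 2 - C (d : ℚ)) = 0 := by simp [hs]
  have hsi : IsIntegral ℚ s := ⟨_, hmon, hev⟩
  rw [IntermediateField.adjoin.finrank hsi]
  apply le_antisymm
  · exact (natDegree_le_of_dvd (minpoly.dvd ℚ s hev) hmon.ne_zero).trans_eq natDegree_X_pow_sub_C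
  · rw [minpoly.two_le_natDegree_iff hsi]
    rintro ⟨q, rfl⟩
    have h1 : q ^ 2 = d := by
      have : ((q ^ 2 : ℚ) : ℂ) = ((d : ℚ) : ℂ) := by push_cast; simpa using hs
      exact_mod_cast this
    have h2 : (d : ℚ) < 0 := by exact_mod_cast hd
    nlinarith [sq_nonneg q]

theorem exists_classGroup_orderOf_eq {N m : ℕ} (hN : N % 4 = 3) (hm : Odd m)
    (h35 : ¬(N = 3 ∧ m = 5)) {d : ℤ} (hd : d = 1 - (N : ℤ) ^ m) (hd0 : d < 0) (hd4 : d % 4 = 2)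
    {s : ℂ} (hs : s ^ 2 = d) :
    ∃ g : ClassGroup (𝓞 (IntermediateField.adjoin ℚ {s})), orderOf g = m := by
  have hm0 : m ≠ 0 := by rintro rfl; exact absurd hm (by decide)
  have hsZ : IsIntegral ℤ s := ⟨X ^ 2 - C d, monic_X_pow_sub_C _ two_ne_zero, by
    rw [eval₂_sub, eval₂_pow, eval₂_X, eval₂_C, hs]; simp⟩
  set K := IntermediateField.adjoin ℚ {s}
  have : NumberField K :=
    { to_finiteDimensional := IntermediateField.adjoin.finiteDimensional hsZ.tower_top }
  let v : K →ₐ[ℤ] ℂ := (IntermediateField.val K).restrictScalars ℤ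
  let φ : 𝓞 K →ₐ[ℤ] ℂ := v.comp (IsScalarTower.toAlgHom ℤ (𝓞 K) K)
  have hφinj : Function.Injective φ :=
    Subtype.val_injective.comp NumberField.RingOfIntegers.coe_injective
  have hφi : ∀ z, IsIntegral ℤ (φ z) := fun z =>
    (NumberField.RingOfIntegers.isIntegral z).map φ
  have hφK : ∀ z, φ z ∈ K := fun z => (z : K).2
  obtain ⟨σ, hσ⟩ : ∃ σ : 𝓞 K, φ σ = s :=
    ⟨⟨IntermediateField.AdjoinSimple.gen ℚ s,
      (isIntegral_algHom_iff v Subtype.val_injective).1 hsZ⟩, rfl⟩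
  have hmul : (1 + σ) * (1 - σ) = (N : 𝓞 K) ^ m := by
    apply hφinj
    simp only [map_mul, map_add, map_sub, map_one, map_pow, map_natCast, hσ]
    rw [hd] at hs
    push_cast at hs
    linear_combination -hs
  have hNodd : Odd (N ^ m) := (Nat.odd_iff.2 (by omega)).pow
  have hcop : IsCoprime (Ideal.span {1 + σ}) (Ideal.span {1 - σ}) := by
    rw [Ideal.isCoprime_span_singleton_iff]
    obtain ⟨k, hk⟩ := hNodd
    have hk' := congrArg (Nat.cast (R := 𝓞 K)) hk
    push_cast at hk'
    -- With N ^ m = 2k + 1, this is (1 + σ)(1 - σ) - k((1 + σ) + (1 - σ)) = N ^ m - 2k = 1.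
    exact ⟨1 - σ - k, -k, by linear_combination hmul + hk'⟩
  obtain ⟨I, hI⟩ := exists_eq_pow_of_mul_eq_pow_of_coprime (c := Ideal.span {(N : 𝓞 K)}) (n := m)
    hcop (by rw [Ideal.span_singleton_mul_span_singleton, hmul, Ideal.span_singleton_pow])
  have hne : 1 + σ ≠ 0 := by
    intro h0
    rw [h0, zero_mul] at hmul
    have h1 : (N : 𝓞 K) ≠ 0 := by exact_mod_cast (by omega : N ≠ 0)
    exact pow_ne_zero m h1 hmul.symm
  have hI0 : I ≠ 0 := by
    rintro rfl
    rw [zero_pow hm0, Ideal.zero_eq_bot, Ideal.span_singleton_eq_bot] at hI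
    exact hne hI
  set g := ClassGroup.mk0 (⟨I, mem_nonZeroDivisors_of_ne_zero hI0⟩ : nonZeroDivisors (Ideal (𝓞 K)))
  have hg : ∀ j : ℕ, g ^ j = 1 ↔ (I ^ j).IsPrincipal := by
    intro j
    rw [← map_pow]
    exact ClassGroup.mk0_eq_one_iff (R := 𝓞 K) (I := I ^ j)
      (pow_mem (mem_nonZeroDivisors_of_ne_zero hI0) j)
  -- It suffices that I ^ (m / r) is not principal for each prime r ∣ m; a generator α would satisfy
  -- α ^ r = ±(1 + σ), the only units being ±1.
  refine ⟨g, orderOf_eq_of_pow_and_pow_div_prime (Nat.pos_of_ne_zero hm0)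
    ((hg m).2 ⟨⟨1 + σ, hI.symm⟩⟩) fun r hr hrm hgr => ?_⟩
  obtain ⟨j, rfl⟩ := hrm
  rw [Nat.mul_div_cancel_left _ hr.pos, hg] at hgr
  obtain ⟨⟨α, hα⟩⟩ := hgr
  obtain ⟨hrodd, hjodd⟩ := Nat.odd_mul.1 hm
  have hassoc : Ideal.span {α ^ r} = Ideal.span {1 + σ} := by
    rw [hI, mul_comm, pow_mul, hα, ← Ideal.span_singleton_pow]
  obtain ⟨u, hu⟩ := Ideal.span_singleton_eq_span_singleton.1 hassoc
  have hu1 := eq_one_or_neg_one_of_isIntegral hd0 hd4 hs (hφK u) (hφi u) (hφK ↑u⁻¹) (hφi ↑u⁻¹)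
    (by rw [← map_mul, Units.mul_inv, map_one])
  have hu' := congrArg φ hu
  simp only [map_mul, map_pow, map_add, map_one, hσ] at hu'
  obtain ⟨h3, h5⟩ := eq_three_of_pow_eq hN hjodd hrodd hr.one_lt.ne' (by rw [hd, mul_comm]) hd0
    hd4 hs (hφK α) (hφi α) (by
      rcases hu1 with h | h
      · left; rw [← hu', h, mul_one]
      · right; rw [← hu', h, mul_neg, mul_one, neg_neg])
  have hj1 : j = 1 := by
    by_contra hj1
    rcases hjodd with ⟨i, rfl⟩
    have h4 : N ^ 2 ≤ N ^ (2 * i + 1) := Nat.pow_le_pow_right (by omega) (by omega)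
    have h6 : 3 ≤ N := by omega
    nlinarith
  subst hj1
  exact h35 ⟨by simpa using h3, by omega⟩

theorem not_irreducible_trinomialNb_three_one :
    ¬ Irreducible ((trinomialNb 3 1).map (Int.castRingHom ℚ)) := by
  intro h
  have h1 : ((trinomialNb 3 1).map (Int.castRingHom ℚ)).IsRoot 2 := by
    rw [IsRoot.def, eval_map]
    simp [trinomialNb]
  have h2 := degree_eq_one_of_irreducible_of_root h h1
  rw [degree_eq_natDegree h.ne_zero] at h2
  norm_cast at h2
  rw [(monic_trinomialNb (by norm_num) 1).natDegree_map,
    natDegree_trinomialNb (by norm_num)] at h2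
  omega

theorem mainTheorem4 (N b : ℕ) (hN : 3 ≤ N) (hN4 : N % 4 = 3) (hb : 1 ≤ b)
    (hirr : Irreducible ((trinomialNb N b).map (Int.castRingHom ℚ))) :
    (IsMonogenicPoly (trinomialNb N b) ↔ Squarefree (deltaNb N b)) ∧
    (∀ b' : ℕ, 1 ≤ b' → b' ≠ b →
      IsMonogenicPoly (trinomialNb N b) → IsMonogenicPoly (trinomialNb N b') →
      ∀ θ θ' : ℂ, aeval θ (trinomialNb N b) = 0 → aeval θ' (trinomialNb N b') = 0 →
        IsEmpty (IntermediateField.adjoin ℚ {θ} ≃ₐ[ℚ] IntermediateField.adjoin ℚ {θ'})) ∧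
    (deltaNb N b < 0 ∧
      ∀ s : ℂ, s ^ 2 = (deltaNb N b : ℂ) →
        Module.finrank ℚ (IntermediateField.adjoin ℚ {s}) = 2 ∧
        ∃ g : ClassGroup (𝓞 (IntermediateField.adjoin ℚ {s})),
          orderOf g = (b + 1) * N - b) := by
  have hN1 : 1 < N := by omega
  have hodd : Odd N := Nat.odd_iff.2 (by omega)
  have hm : Odd ((b + 1) * N - b) := by
    rw [delta_exponent_eq hN1.le]
    obtain ⟨k, rfl⟩ := hodd
    exact ⟨(b + 1) * k, by simp only [Nat.add_sub_cancel]; ring⟩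
  have hmod : ((N : ℤ) ^ ((b + 1) * N - b)) % 4 = 3 := by
    have h1 : (N : ℤ) ≡ -1 [ZMOD 4] := Int.modEq_iff_dvd.2 (by omega)
    have h2 := h1.pow ((b + 1) * N - b)
    rw [hm.neg_one_pow] at h2
    have := Int.modEq_iff_dvd.1 h2
    omega
  have hpos : 0 ≤ (N : ℤ) ^ ((b + 1) * N - b) := by positivity
  have hd0 : deltaNb N b < 0 := by rw [deltaNb]; omega
  have hd4 : deltaNb N b % 4 = 2 := by rw [deltaNb]; omega
  refine ⟨⟨squarefree_of_isMonogenicPoly hN1 hodd, isMonogenicPoly_of_squarefree hN1 hodd hirr⟩,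
    fun b' _ hbb' h h' θ θ' hθ hθ' => isEmpty_algEquiv_of_isMonogenicPoly hN1 hodd hbb' h h' hθ hθ',
    hd0, fun s hs => ⟨finrank_adjoin_eq_two hd0 hs, ?_⟩⟩
  refine exists_classGroup_orderOf_eq hN4 hm ?_ rfl hd0 hd4 hs
  -- The exponent 2b + 3 equals 5 only for b = 1, where δ = -242 and the trinomial x ^ 3 - x - 6 is
  -- reducible.
  rintro ⟨rfl, h5⟩
  obtain rfl : b = 1 := by omega
  exact not_irreducible_trinomialNb_three_one hirr
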